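/- **Setting.** Let $G$ be the Coxeter diagram of a Coxeter group with finitely many generators, with Coxeter matrix $(m_{ij})$, and let $A$ be a crystallographic Cartan matrix for it: an integer matrix with $A_{ii}=2$, $A_{ij}\le 0$ for $i\ne j$, $A_{ij}=0$ if $m_{ij}=2$, $A_{ij}A_{ji}=4\cos^2(\pi/m_{ij})$ if $3\le m_{ij}<\infty$, and $A_{ij}A_{ji}\ge 4$ if $m_{ij}=\infty$. Integer-valued functions on the vertices are identified with combinations of the simple roots $\alpha_i$; put $s_i(\beta)=\beta-\big(\sum_j A_{ij}\beta(j)\big)\alpha_i$. The roots are the images of the simple roots under products of the $s_i$, and a root is positive if its coefficients are all $\ge 0$. For positive roots $\beta,\gamma$, write $\beta\le\gamma$ in the (Björner–Brenti) root poset if $\gamma$ is obtained from $\beta$ by successively applying simple reflections, each of which changes the current root by a positive multiple of the corresponding simple root. Let $\downarrow\!\alpha$ be the set of positive roots $\beta\le\alpha$. Fix a vertex $x$ of $G$ and a partition $L_x\sqcup R_x$ of its neighbors. The stretched diagram $\mathrm{st}_n(G)$ replaces $x$ by a path $x_0,\dots,x_n$ (the stretched path), with $x_0$ joined to $L_x$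 and $x_n$ joined to $R_x$. Its Cartan matrix $\mathrm{st}_n(A)$ agrees with $A$ off the path, has $2$ at $(x_i,x_i)$, $-1$ at $(x_i,x_{i\pm1})$, has the entries $A_{xz},A_{zx}$ of $A$ between $x_0$ and $z\in L_x$ and between $x_n$ and $z\in R_x$, and is $0$ otherwise. The function $\mathrm{st}_n(\alpha)$ equals $\alpha(x)$ on every $x_i$ and $\alpha$ elsewhere. **Stretching classes.** A stretching class $\bar\beta$ is given by a notation: an integer-valued function on the vertices of some $\mathrm{st}_m(G)$ together with asterisks on a nonempty set of consecutive vertices of the stretched path, no two adjacent asterisked values being equal. For each $n$, $\bar\beta[n]$ is the set of functions on $\mathrm{st}_n(G)$ that take the non-asterisked values at the prescribed places (each exactly once) and the asterisked values along the stretched path in the prescribed order, each repeated any nonzero number of times. The left (right) endpoint is the leftmost (rightmost) asterisked vertex; the other asterisked vertices are internal. If $x_\ell$ is the left endpoint, the weighted left sum is $\sum_y -\mathrm{st}_m(A)_{x_\ell y}\,\bar\beta(y)$ over the neighbors $y$ to the left of $x_\ell$ (that is, over $L_x$ if $\ell=0$, and over $\{x_{\ell-1}\}$ otherwise); the weighted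 right sum is defined symmetrically. **The graph $P$.** Let $\alpha$ be a positive root of $A$. Let $P$ be the directed graph whose vertices are all notations that can be reached by arrows from $\alpha^*$, the function $\alpha$ on $\mathrm{st}_0(G)=G$ with an asterisk on its value at $x$. There is an arrow $\bar\beta\to\bar\gamma$ when $\bar\gamma$ has no negative coefficient and arises from $\bar\beta$ by one of the following operations, where reflections are applied to the defining function, ignoring asterisks: 1. reflect at a vertex without an asterisk, so that its coefficient decreases; 2. reflect at an internal vertex, so that its coefficient decreases; 3. if the weighted left (right) sum is less than the coefficient of the left (right) endpoint, insert that sum, with an asterisk, as the new left (right) endpoint; 4. if at least two vertices have an asterisk, reflect at the left (right) endpoint so that its coefficient decreases, and remove the asterisk of that endpoint if its new coefficient is greater than or equal to the adjacent asterisked coefficient. **Theorem.** $P$ is finite and acyclic, and each notation in it satisfies the condition that no two adjacent asterisked values are equal. There is a smallest $n_0\ge 0$ such that every stretching class in $P$ with exactly one asterisk has an element defined on $\mathrm{st}_{n_0}(G)$, and for all $n\ge n_0+1$ $$\downarrow\!\mathrm{st}_n(\alpha)=\bigcup_{\bar\beta\in P}\bar\beta[n].$$ Moreover, the containment $\bigcup_{\bar\beta\in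 P}\bar\beta[n]\subseteq{\downarrow}\,\mathrm{st}_n(\alpha)$ holds for every $n\ge 0$. -/

import Mathlib

/-! ### Crystallographic Cartan matrices, roots and the root poset -/

/-- `A` is a crystallographic (integral) Cartan matrix for the Coxeter matrix `M`.
In Mathlib's convention the entry `0` of `M` stands for `∞`. -/
structure IsCartanMatrix {V : Type*} (M : CoxeterMatrix V) (A : Matrix V V ℤ) : Prop where
  diag : ∀ i, A i i = 2
  nonpos : ∀ i j, i ≠ j → A i j ≤ 0
  two : ∀ i j, M i j = 2 → A i j = 0
  finite : ∀ i j, 3 ≤ M i j →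
    ((A i j * A j i : ℤ) : ℝ) = 4 * Real.cos (Real.pi / (M i j : ℝ)) ^ 2
  infinite : ∀ i j, M i j = 0 → 4 ≤ A i j * A j i

/-- The graph underlying the Coxeter diagram: distinct `i`, `j` are joined when `m_{ij} ≥ 3`
(possibly `∞`), that is, when `m_{ij} ≠ 2`. -/
def coxeterDiagram {V : Type*} (M : CoxeterMatrix V) : SimpleGraph V where
  Adj i j := i ≠ j ∧ M i j ≠ 2
  symm := ⟨fun i j h => ⟨h.1.symm, fun hji => h.2 ((M.symmetric i j).trans hji)⟩⟩
  loopless := ⟨fun _ h => h.1 rfl⟩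

section RootPoset

variable {I : Type*} [Fintype I] [DecidableEq I]

/-- The simple root `α_i`, as an integer-valued function on the vertices. -/
def simpleRoot (i : I) : I → ℤ := Pi.single i 1

/-- The simple reflection `s_i(β) = β - (α_i, β) α_i`, where `(α_i, α_j) = A i j`. -/
def simpleReflection (A : Matrix I I ℤ) (i : I) (β : I → ℤ) : I → ℤ :=
  β - (∑ j, A i j * β j) • simpleRoot i

/-- `β` is a root: it lies in the orbit of a simple root under the group generated by the
simple reflections (which are involutions, so words in them suffice). -/
def IsRoot (A : Matrix I I ℤ) (β : I → ℤ) : Prop :=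
  ∃ (w : List I) (i : I), β = w.foldr (simpleReflection A) (simpleRoot i)

/-- A positive root: a root all of whose coefficients are nonnegative. -/
def IsPositiveRoot (A : Matrix I I ℤ) (β : I → ℤ) : Prop :=
  IsRoot A β ∧ ∀ i, 0 ≤ β i

/-- One step upwards: `γ = s_i(β)`, and `s_i(β) - β` is a positive multiple of `α_i`. -/
def RootStep (A : Matrix I I ℤ) (β γ : I → ℤ) : Prop :=
  ∃ i, γ = simpleReflection A i β ∧ ∃ c : ℤ, 0 < c ∧ γ - β = c • simpleRoot i

/-- The order of the (Björner–Brenti) root poset on positive roots. -/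
def RootLE (A : Matrix I I ℤ) (β γ : I → ℤ) : Prop :=
  IsPositiveRoot A β ∧ IsPositiveRoot A γ ∧ Relation.ReflTransGen (RootStep A) β γ

/-- The set of positive roots below `α` in the root poset. -/
def downset (A : Matrix I I ℤ) (α : I → ℤ) : Set (I → ℤ) :=
  {β | RootLE A β α}

end RootPoset

/-! ### Stretching -/

/-- Elastic data for a Coxeter diagram: a vertex `x` together with a partition of its neighbors
into left neighbors and right neighbors (either of which may be empty). -/
structure ElasticData {V : Type*} [DecidableEq V] (M : CoxeterMatrix V) where
  x : V
  left : Finset V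
  right : Finset V
  disjoint : Disjoint left right
  neighbors : ∀ y, y ∈ left ∪ right ↔ (coxeterDiagram M).Adj x y

namespace ElasticData

variable {V : Type*} [DecidableEq V] {M : CoxeterMatrix V}

/-- The vertices of the `n`-stretched diagram: `Sum.inl v` for the vertices `v ≠ x` of the
original diagram, and `Sum.inr i` for the vertex `x_i` of the stretched path, `0 ≤ i ≤ n`. -/
abbrev Vertex (E : ElasticData M) (n : ℕ) : Type _ := {v : V // v ≠ E.x} ⊕ Fin (n + 1)

/-- The `n`-stretched Cartan matrix. -/
def stCartan (E : ElasticData M) (A : Matrix V V ℤ) (n : ℕ) :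
    Matrix (E.Vertex n) (E.Vertex n) ℤ
  | Sum.inl y, Sum.inl z => A y z
  | Sum.inr i, Sum.inl z =>
      if (i = 0 ∧ z.1 ∈ E.left) ∨ (i = Fin.last n ∧ z.1 ∈ E.right) then A E.x z else 0
  | Sum.inl y, Sum.inr i =>
      if (i = 0 ∧ y.1 ∈ E.left) ∨ (i = Fin.last n ∧ y.1 ∈ E.right) then A y E.x else 0
  | Sum.inr i, Sum.inr j =>
      if i = j then 2 else if (i : ℕ) + 1 = j ∨ (j : ℕ) + 1 = i then -1 else 0

/-- The `n`-stretch of a function on the vertices. -/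
def stretch (E : ElasticData M) (n : ℕ) (α : V → ℤ) : E.Vertex n → ℤ :=
  Sum.elim (fun v => α v) (fun _ => α E.x)

/-- `v` is a neighbor to the left of `x_i`: a vertex of `L_x` when `i = 0`,
and `x_{i-1}` otherwise. -/
def IsLeftNeighbor (E : ElasticData M) {m : ℕ} (i : Fin (m + 1)) : E.Vertex m → Prop
  | Sum.inl v => i = 0 ∧ v.1 ∈ E.left
  | Sum.inr j => (j : ℕ) + 1 = i

/-- `v` is a neighbor to the right of `x_i`: a vertex of `R_x` when `i = m`,
and `x_{i+1}` otherwise. -/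
def IsRightNeighbor (E : ElasticData M) {m : ℕ} (i : Fin (m + 1)) : E.Vertex m → Prop
  | Sum.inl v => i = Fin.last m ∧ v.1 ∈ E.right
  | Sum.inr j => (i : ℕ) + 1 = j

end ElasticData

/-! ### Stretching classes -/

/-- The defining notation of a stretching class: an integer-valued function on the vertices of
the `m`-stretched diagram, whose values at the consecutive path vertices `x_lo, …, x_hi`
(at least one) carry an asterisk. -/
structure StretchingNotation {V : Type*} [DecidableEq V] {M : CoxeterMatrix V}
    (E : ElasticData M) where
  m : ℕ
  val : E.Vertex m → ℤ
  lo : Fin (m + 1)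
  hi : Fin (m + 1)
  lo_le_hi : lo ≤ hi

namespace StretchingNotation

variable {V : Type*} [DecidableEq V] {M : CoxeterMatrix V} {E : ElasticData M}

/-- The constraint on notations: no two adjacent asterisked values are the same. -/
def Admissible (β : StretchingNotation E) : Prop :=
  ∀ i j : Fin (β.m + 1), β.lo ≤ i → j ≤ β.hi → (i : ℕ) + 1 = j →
    β.val (Sum.inr i) ≠ β.val (Sum.inr j)

/-- The vertex carries an asterisk. -/
def Asterisked (β : StretchingNotation E) : E.Vertex β.m → Prop
  | Sum.inl _ => False
  | Sum.inr i => β.lo ≤ i ∧ i ≤ β.hi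

/-- The members of the stretching class that are defined on the `n`-stretched diagram: the
functions obtained by repeating the value at each asterisked vertex any nonzero number of times.
The map `φ` sends a position on the long path to the vertex of the notation it represents. -/
def slice (β : StretchingNotation E) (n : ℕ) : Set (E.Vertex n → ℤ) :=
  {g | (∀ v, g (Sum.inl v) = β.val (Sum.inl v)) ∧
    ∃ φ : Fin (n + 1) → Fin (β.m + 1), Monotone φ ∧ Function.Surjective φ ∧
      (∀ i j, φ i = φ j → ¬ β.Asterisked (Sum.inr (φ i)) → i = j) ∧
      ∀ i, g (Sum.inr i) = β.val (Sum.inr (φ i))}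

/-- The notation has exactly one asterisk. -/
def SingleAsterisk (β : StretchingNotation E) : Prop := β.lo = β.hi

/-- The notation `α*`: the function `α` (on the `0`-stretched diagram), with an asterisk on its
value at `x`. -/
def star (E : ElasticData M) (α : V → ℤ) : StretchingNotation E where
  m := 0
  val := E.stretch 0 α
  lo := 0
  hi := 0
  lo_le_hi := le_rfl

variable [Fintype V]

/-- Reflect the defining function at a vertex, ignoring the asterisks. -/
def reflectVal (A : Matrix V V ℤ) (β : StretchingNotation E) (v : E.Vertex β.m) :
    E.Vertex β.m → ℤ :=
  simpleReflection (E.stCartan A β.m) v β.val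

/-- Reflect at a vertex and keep all the asterisks. -/
def reflect (A : Matrix V V ℤ) (β : StretchingNotation E) (v : E.Vertex β.m) :
    StretchingNotation E :=
  { β with val := β.reflectVal A v }

open Classical in
/-- The weighted left sum, over the neighbors to the left of the left endpoint. -/
noncomputable def leftSum (A : Matrix V V ℤ) (β : StretchingNotation E) : ℤ :=
  ∑ v with E.IsLeftNeighbor β.lo v, -E.stCartan A β.m (Sum.inr β.lo) v * β.val v

open Classical in
/-- The weighted right sum, over the neighbors to the right of the right endpoint. -/
noncomputable def rightSum (A : Matrix V V ℤ) (β : StretchingNotation E) : ℤ :=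
  ∑ v with E.IsRightNeighbor β.hi v, -E.stCartan A β.m (Sum.inr β.hi) v * β.val v

/-- Insert the value `c` with an asterisk as the new left endpoint, just before the old one. -/
def insertLeft (β : StretchingNotation E) (c : ℤ) : StretchingNotation E where
  m := β.m + 1
  val := Sum.elim (fun v => β.val (Sum.inl v))
    (Fin.insertNth (α := fun _ => ℤ) β.lo.castSucc c (fun i => β.val (Sum.inr i)))
  lo := β.lo.castSucc
  hi := β.hi.succ
  lo_le_hi := (Fin.castSucc_le_castSucc_iff.2 β.lo_le_hi).trans Fin.castSucc_lt_succ.le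

/-- Insert the value `c` with an asterisk as the new right endpoint, just after the old one. -/
def insertRight (β : StretchingNotation E) (c : ℤ) : StretchingNotation E where
  m := β.m + 1
  val := Sum.elim (fun v => β.val (Sum.inl v))
    (Fin.insertNth (α := fun _ => ℤ) β.hi.succ c (fun i => β.val (Sum.inr i)))
  lo := β.lo.castSucc
  hi := β.hi.succ
  lo_le_hi := (Fin.castSucc_le_castSucc_iff.2 β.lo_le_hi).trans Fin.castSucc_lt_succ.le

/-- The four kinds of operations on (notations for) stretching classes. -/
inductive Operation (A : Matrix V V ℤ) : StretchingNotation E → StretchingNotation E → Prop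
  /-- Reflect at a vertex without an asterisk, decreasing its coefficient. -/
  | unmarked (β : StretchingNotation E) (v : E.Vertex β.m) (hv : ¬ β.Asterisked v)
      (hdec : β.reflectVal A v v < β.val v) :
      Operation A β (β.reflect A v)
  /-- Reflect at an internal vertex, decreasing its coefficient. -/
  | internal (β : StretchingNotation E) (i : Fin (β.m + 1)) (hlo : β.lo < i) (hhi : i < β.hi)
      (hdec : β.reflectVal A (Sum.inr i) (Sum.inr i) < β.val (Sum.inr i)) :
      Operation A β (β.reflect A (Sum.inr i))
  /-- Insert the weighted left sum, if less than the left endpoint's coefficient. -/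
  | insertLeft (β : StretchingNotation E) (hlt : β.leftSum A < β.val (Sum.inr β.lo)) :
      Operation A β (β.insertLeft (β.leftSum A))
  /-- Insert the weighted right sum, if less than the right endpoint's coefficient. -/
  | insertRight (β : StretchingNotation E) (hlt : β.rightSum A < β.val (Sum.inr β.hi)) :
      Operation A β (β.insertRight (β.rightSum A))
  /-- With at least two asterisks, reflect at the left endpoint, decreasing its
  coefficient; the result is less than the adjacent asterisked coefficient. -/
  | leftKeep (β : StretchingNotation E) (k : Fin (β.m + 1))
      (hk : (β.lo : ℕ) + 1 = k) (hkhi : k ≤ β.hi)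
      (hdec : β.reflectVal A (Sum.inr β.lo) (Sum.inr β.lo) < β.val (Sum.inr β.lo))
      (hlt : β.reflectVal A (Sum.inr β.lo) (Sum.inr β.lo) < β.val (Sum.inr k)) :
      Operation A β (β.reflect A (Sum.inr β.lo))
  /-- As in the preceding case, but the result is at least the adjacent asterisked coefficient:
  the left endpoint loses its asterisk. -/
  | leftDrop (β : StretchingNotation E) (k : Fin (β.m + 1))
      (hk : (β.lo : ℕ) + 1 = k) (hkhi : k ≤ β.hi)
      (hdec : β.reflectVal A (Sum.inr β.lo) (Sum.inr β.lo) < β.val (Sum.inr β.lo))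
      (hge : β.val (Sum.inr k) ≤ β.reflectVal A (Sum.inr β.lo) (Sum.inr β.lo)) :
      Operation A β ⟨β.m, β.reflectVal A (Sum.inr β.lo), k, β.hi, hkhi⟩
  /-- With at least two asterisks, reflect at the right endpoint, decreasing its
  coefficient; the result is less than the adjacent asterisked coefficient. -/
  | rightKeep (β : StretchingNotation E) (k : Fin (β.m + 1))
      (hk : (k : ℕ) + 1 = β.hi) (hklo : β.lo ≤ k)
      (hdec : β.reflectVal A (Sum.inr β.hi) (Sum.inr β.hi) < β.val (Sum.inr β.hi))
      (hlt : β.reflectVal A (Sum.inr β.hi) (Sum.inr β.hi) < β.val (Sum.inr k)) :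
      Operation A β (β.reflect A (Sum.inr β.hi))
  /-- As in the preceding case, but the result is at least the adjacent asterisked coefficient:
  the right endpoint loses its asterisk. -/
  | rightDrop (β : StretchingNotation E) (k : Fin (β.m + 1))
      (hk : (k : ℕ) + 1 = β.hi) (hklo : β.lo ≤ k)
      (hdec : β.reflectVal A (Sum.inr β.hi) (Sum.inr β.hi) < β.val (Sum.inr β.hi))
      (hge : β.val (Sum.inr k) ≤ β.reflectVal A (Sum.inr β.hi) (Sum.inr β.hi)) :
      Operation A β ⟨β.m, β.reflectVal A (Sum.inr β.hi), β.lo, k, hklo⟩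

/-- The arrows of the graph: operations that do not result in a negative coefficient. -/
def Arrow (A : Matrix V V ℤ) (β γ : StretchingNotation E) : Prop :=
  Operation A β γ ∧ ∀ v, 0 ≤ γ.val v

/-- The vertex set of the graph `P` built from `α`: everything that is reached from `α*` by
iterating the operations. Its arrows are given by `Arrow`. -/
def stableGraph (E : ElasticData M) (A : Matrix V V ℤ) (α : V → ℤ) :
    Set (StretchingNotation E) :=
  {β | Relation.ReflTransGen (Arrow A) (star E α) β}

end StretchingNotation

/-! Write a function on the stretched diagram as a sequence `p 0, …, p (n + 2)`: the values along
the path, framed by the weighted sums over `L_x` and `R_x`. Reflecting at `x_j` replaces `p (j + 1)`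
by `p j + p (j + 2) - p (j + 1)`, that is, exchanges two consecutive differences. A member of a
stretching class consists of constant blocks, and the effect of reflecting a path value is visible
from its neighbours. Inside a block nothing happens. At the edge of a block of length at least two,
the edge moves by one place (same class), or, at the outer edge of an endpoint block, the weighted
sum appears as a new value (insertion). A value taken once is reflected as in the notation. Vertices
off the path see only the two ends of the path.

Hence a decreasing reflection of a member stays in the class or follows an operation
(`exists_operation`), unless the sole asterisked value is taken exactly once, which forces `n = m`.
Taking `n` above `n₀` excludes this, so the union of the slices is closed downwards.

Conversely (`slice_subset_of_arrow`), let an arrow lead from `β` to `γ`. The changed value is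
unmarked in `γ` or lies next to a larger asterisked value. In the second case its block can be
shortened to one place by increasing reflections; one more increasing reflection then gives a member
of `β`. Thus slices of reachable classes lie below the stretch of `α`, which is a root because `s_x`
is simulated by a palindromic word in the path reflections (`isRoot_stretch_simpleReflection`).

Finiteness holds because the length index `m` plus the two endpoint values never increases and
coefficients stay between `0` and the maximum of `α`; acyclicity holds because each operation
lengthens the path or lowers the coefficient sum. -/

section Reflection

/-! ### Simple reflections and lower sets -/

variable {I : Type*} [Fintype I] [DecidableEq I]

theorem simpleReflection_self (A : Matrix I I ℤ) (i : I) (β : I → ℤ) :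
    simpleReflection A i β i = β i - ∑ j, A i j * β j := by
  simp [simpleReflection, simpleRoot]

theorem simpleReflection_of_ne (A : Matrix I I ℤ) {i k : I} (h : k ≠ i) (β : I → ℤ) :
    simpleReflection A i β k = β k := by
  simp [simpleReflection, simpleRoot, h]

theorem simpleReflection_simpleReflection (A : Matrix I I ℤ) {i : I} (hi : A i i = 2)
    (β : I → ℤ) : simpleReflection A i (simpleReflection A i β) = β := by
  have key : ∑ j, A i j * simpleReflection A i β j = -∑ j, A i j * β j := by
    simp only [simpleReflection, simpleRoot, Pi.sub_apply, Pi.smul_apply, smul_eq_mul, mul_sub,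
      Finset.sum_sub_distrib, Pi.single_apply, mul_ite, mul_one, mul_zero, Finset.sum_ite_eq',
      Finset.mem_univ, if_true, hi]
    ring
  ext k
  by_cases hk : k = i
  · subst hk
    rw [simpleReflection_self, key, simpleReflection_self]
    ring
  · rw [simpleReflection_of_ne A hk, simpleReflection_of_ne A hk]

theorem isRoot_simpleReflection {A : Matrix I I ℤ} {β : I → ℤ} (h : IsRoot A β) (i : I) :
    IsRoot A (simpleReflection A i β) := by
  obtain ⟨w, k, rfl⟩ := h
  exact ⟨i :: w, k, rfl⟩

theorem mem_downset_of_simpleReflection {A : Matrix I I ℤ} {α g : I → ℤ} {i : I}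
    (hi : A i i = 2) (h : simpleReflection A i g ∈ downset A α) (hg : ∀ k, 0 ≤ g k)
    (hlt : g i < simpleReflection A i g i) : g ∈ downset A α := by
  obtain ⟨h1, h2, h3⟩ := h
  refine ⟨⟨?_, hg⟩, h2, h3.head ⟨i, rfl, _, sub_pos.2 hlt, ?_⟩⟩
  · rw [← simpleReflection_simpleReflection A hi g]
    exact isRoot_simpleReflection h1.1 i
  · ext k
    by_cases hk : k = i
    · subst hk
      simp [simpleRoot]
    · simp [simpleRoot, hk, simpleReflection_of_ne A hk]

/-- A set which is closed under decreasing simple reflections that keep nonnegativity contains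
the lower set of each of its elements. -/
theorem downset_subset {A : Matrix I I ℤ} (hA : ∀ i, A i i = 2) {α : I → ℤ} {S : Set (I → ℤ)}
    (hα : α ∈ S)
    (hS : ∀ g ∈ S, ∀ i, simpleReflection A i g i < g i → (∀ k, 0 ≤ simpleReflection A i g k) →
      simpleReflection A i g ∈ S) : downset A α ⊆ S := by
  rintro β ⟨⟨-, h1⟩, -, h3⟩
  induction h3 using Relation.ReflTransGen.head_induction_on with
  | refl => exact hα
  | @head a b hab _ ih =>
    obtain ⟨i, rfl, c, hc, hac⟩ := hab
    have hi : simpleReflection A i a i = a i + c := by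
      have := congrFun hac i
      simp [simpleRoot] at this
      linarith
    have hb : ∀ k, 0 ≤ simpleReflection A i a k := by
      intro k
      by_cases hk : k = i
      · subst hk
        linarith [h1 k]
      · rw [simpleReflection_of_ne A hk]
        exact h1 k
    -- The poset step goes up from `a`; read backwards through the involution it is a decreasing
    -- reflection, to which `hS` applies.
    have hback := simpleReflection_simpleReflection A (hA i) a
    have := hS _ (ih hb) i (by rw [hback]; linarith) (by rw [hback]; exact h1)
    rwa [hback] at this

end Reflection

/-! ### The stretched Cartan matrix in terms of profiles -/

namespace ElasticData

variable {V : Type*} [Fintype V] [DecidableEq V] {M : CoxeterMatrix V}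

/-- The weighted sum over the left neighbors of the stretched path. -/
def leftWeight (E : ElasticData M) (A : Matrix V V ℤ) (u : {v : V // v ≠ E.x} → ℤ) : ℤ :=
  ∑ z : {v : V // v ≠ E.x}, if z.1 ∈ E.left then -A E.x z * u z else 0

/-- The weighted sum over the right neighbors of the stretched path. -/
def rightWeight (E : ElasticData M) (A : Matrix V V ℤ) (u : {v : V // v ≠ E.x} → ℤ) : ℤ :=
  ∑ z : {v : V // v ≠ E.x}, if z.1 ∈ E.right then -A E.x z * u z else 0

/-- The values along the stretched path, in positions `1, …, n + 1`, between the two weighted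
sums over the neighbors of the path, in positions `0` and `n + 2`. -/
def profile (E : ElasticData M) (A : Matrix V V ℤ) {n : ℕ} (g : E.Vertex n → ℤ) (k : ℕ) : ℤ :=
  if k = 0 then E.leftWeight A (fun v => g (Sum.inl v))
  else if h : k - 1 < n + 1 then g (Sum.inr ⟨k - 1, h⟩)
  else E.rightWeight A (fun v => g (Sum.inl v))

variable (E : ElasticData M) (A : Matrix V V ℤ) {n : ℕ}

theorem profile_zero (g : E.Vertex n → ℤ) :
    E.profile A g 0 = E.leftWeight A (fun v => g (Sum.inl v)) := by
  simp [profile]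

theorem profile_of_le (g : E.Vertex n → ℤ) {k : ℕ} (hk : n + 2 ≤ k) :
    E.profile A g k = E.rightWeight A (fun v => g (Sum.inl v)) := by
  rw [profile, if_neg (by omega), dif_neg (by omega)]

theorem profile_succ (g : E.Vertex n → ℤ) (i : Fin (n + 1)) :
    E.profile A g (i + 1) = g (Sum.inr i) := by
  rw [profile, if_neg (by omega), dif_pos (by omega)]
  rfl

omit [Fintype V] in
theorem stCartan_self (hA : ∀ i, A i i = 2) (v : E.Vertex n) : E.stCartan A n v v = 2 := by
  cases v <;> simp [stCartan, hA]

/-- The row of a path vertex is a discrete second difference; the extra entries at positions `0` and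
`n + 2` absorb the neighbours off the path, so the ends need no separate treatment later. -/
theorem sum_stCartan_inr (g : E.Vertex n → ℤ) (j : Fin (n + 1)) :
    ∑ v, E.stCartan A n (Sum.inr j) v * g v =
      2 * g (Sum.inr j) - E.profile A g j - E.profile A g (j + 2) := by
  have h1 : ∑ z : {v : V // v ≠ E.x}, E.stCartan A n (Sum.inr j) (Sum.inl z) * g (Sum.inl z) =
      -(if j = 0 then E.leftWeight A (fun v => g (Sum.inl v)) else 0)
      - (if j = Fin.last n then E.rightWeight A (fun v => g (Sum.inl v)) else 0) := by
    have hz : ∀ z : {v : V // v ≠ E.x},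
        E.stCartan A n (Sum.inr j) (Sum.inl z) * g (Sum.inl z) =
        -(if j = 0 then (if z.1 ∈ E.left then -A E.x z * g (Sum.inl z) else 0) else 0)
        - (if j = Fin.last n then (if z.1 ∈ E.right then -A E.x z * g (Sum.inl z) else 0)
          else 0) := by
      intro z
      -- For `n = 0` the vertex is both first and last; disjointness keeps a neighbour from being
      -- counted on both sides.
      have hd : z.1 ∈ E.left → z.1 ∉ E.right := fun h h' =>
        (Finset.disjoint_left.1 E.disjoint h h').elim
      simp only [stCartan]
      split_ifs <;> first | ring1 | (exfalso; tauto)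
    rw [Finset.sum_congr rfl (fun z _ => hz z), Finset.sum_sub_distrib, Finset.sum_neg_distrib]
    simp only [leftWeight, rightWeight]
    split_ifs <;> simp
  have h2 : ∑ i : Fin (n + 1), E.stCartan A n (Sum.inr j) (Sum.inr i) * g (Sum.inr i) =
      2 * g (Sum.inr j) - (if j = 0 then 0 else E.profile A g j)
      - (if j = Fin.last n then 0 else E.profile A g (j + 2)) := by
    have hz : ∀ i : Fin (n + 1),
        E.stCartan A n (Sum.inr j) (Sum.inr i) * g (Sum.inr i) =
        (if j = i then 2 * g (Sum.inr i) else 0)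
        - (if (i : ℕ) + 1 = j then g (Sum.inr i) else 0)
        - (if (j : ℕ) + 1 = i then g (Sum.inr i) else 0) := by
      intro i
      simp only [stCartan, Fin.ext_iff]
      split_ifs <;> first | ring1 | omega
    rw [Finset.sum_congr rfl (fun z _ => hz z), Finset.sum_sub_distrib, Finset.sum_sub_distrib,
      Finset.sum_ite_eq, if_pos (Finset.mem_univ _)]
    congr 1
    · congr 1
      by_cases hj : j = 0
      · rw [if_pos hj]
        refine Finset.sum_eq_zero fun i _ => if_neg ?_
        simp [hj]
      · rw [if_neg hj]
        have hj' : (j : ℕ) ≠ 0 := fun h => hj (Fin.ext h)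
        have : E.profile A g j = g (Sum.inr ⟨j - 1, by omega⟩) := by
          rw [profile, if_neg hj', dif_pos (by omega)]
        rw [this, Finset.sum_eq_single ⟨j - 1, by omega⟩]
        · rw [if_pos (by simp; omega)]
        · intro i _ hi
          refine if_neg fun h => hi (Fin.ext ?_)
          simp
          omega
        · simp
    · by_cases hj : j = Fin.last n
      · rw [if_pos hj]
        refine Finset.sum_eq_zero fun i _ => if_neg ?_
        have := i.2
        simp [hj]
        omega
      · rw [if_neg hj]
        have hj' : (j : ℕ) < n := Fin.val_lt_last hj
        rw [Finset.sum_eq_single ⟨j + 1, by omega⟩]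
        · rw [if_pos (by simp), ← profile_succ E A g]
        · intro i _ hi
          refine if_neg fun h => hi (Fin.ext ?_)
          simp
          omega
        · simp
  rw [Fintype.sum_sum_type, h1, h2]
  have e1 : j = 0 → E.profile A g j = E.leftWeight A (fun v => g (Sum.inl v)) := by
    rintro rfl
    exact profile_zero E A g
  have e2 : j = Fin.last n →
      E.profile A g (j + 2) = E.rightWeight A (fun v => g (Sum.inl v)) := by
    rintro rfl
    exact profile_of_le E A g (by simp)
  split_ifs with hj hj' hj'
  · rw [e1 hj, e2 hj']
    ring
  · rw [e1 hj]
    ring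
  · rw [e2 hj']
    ring
  · ring

theorem simpleReflection_inr_inl (g : E.Vertex n → ℤ) (j : Fin (n + 1))
    (z : {v : V // v ≠ E.x}) :
    simpleReflection (E.stCartan A n) (Sum.inr j) g (Sum.inl z) = g (Sum.inl z) :=
  simpleReflection_of_ne _ (by simp) _

/-- The differences on both sides of the reflected value are exchanged. In particular, a value equal
to one neighbour becomes equal to the other. -/
theorem simpleReflection_inr_self (g : E.Vertex n → ℤ) (j : Fin (n + 1)) :
    simpleReflection (E.stCartan A n) (Sum.inr j) g (Sum.inr j) =
      E.profile A g j + E.profile A g (j + 2) - E.profile A g (j + 1) := by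
  rw [simpleReflection_self, sum_stCartan_inr, profile_succ]
  ring

theorem profile_congr {m : ℕ} {f : E.Vertex m → ℤ} {g : E.Vertex n → ℤ}
    (h : ∀ v, f (Sum.inl v) = g (Sum.inl v)) :
    E.profile A f 0 = E.profile A g 0 ∧ E.profile A f (m + 2) = E.profile A g (n + 2) := by
  have : (fun v => f (Sum.inl v)) = fun v => g (Sum.inl v) := funext h
  rw [profile_zero, profile_zero, profile_of_le E A f le_rfl, profile_of_le E A g le_rfl, this]
  exact ⟨rfl, rfl⟩

theorem profile_simpleReflection_inr (g : E.Vertex n → ℤ) (j : Fin (n + 1)) (k : ℕ) :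
    E.profile A (simpleReflection (E.stCartan A n) (Sum.inr j) g) k =
      if k = j + 1 then E.profile A g j + E.profile A g (j + 2) - E.profile A g (j + 1)
      else E.profile A g k := by
  split_ifs with h
  · rw [h, profile_succ, simpleReflection_inr_self]
  · simp only [profile, simpleReflection_inr_inl]
    split_ifs with h1 h2
    · rfl
    · refine simpleReflection_of_ne _ ?_ _
      simp [Fin.ext_iff]
      omega
    · rfl

theorem simpleReflection_inl_inr (g : E.Vertex n → ℤ) (j : Fin (n + 1))
    (z : {v : V // v ≠ E.x}) :
    simpleReflection (E.stCartan A n) (Sum.inl z) g (Sum.inr j) = g (Sum.inr j) :=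
  simpleReflection_of_ne _ (by simp) _

/-- Only the two ends of the path enter, so a reflection off the path does not notice how often
values are repeated along it. -/
theorem sum_stCartan_inl (g : E.Vertex n → ℤ) (z : {v : V // v ≠ E.x}) :
    ∑ v, E.stCartan A n (Sum.inl z) v * g v =
      ∑ y : {v : V // v ≠ E.x}, A z y * g (Sum.inl y)
      + ((if z.1 ∈ E.left then A z E.x else 0) * g (Sum.inr 0)
        + (if z.1 ∈ E.right then A z E.x else 0) * g (Sum.inr (Fin.last n))) := by
  rw [Fintype.sum_sum_type]
  congr 1
  have hz : ∀ i : Fin (n + 1), E.stCartan A n (Sum.inl z) (Sum.inr i) * g (Sum.inr i) =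
      (if i = 0 then (if z.1 ∈ E.left then A z E.x else 0) * g (Sum.inr i) else 0)
      + (if i = Fin.last n then (if z.1 ∈ E.right then A z E.x else 0) * g (Sum.inr i)
        else 0) := by
    intro i
    have hd : z.1 ∈ E.left → z.1 ∉ E.right := fun h h' =>
      (Finset.disjoint_left.1 E.disjoint h h').elim
    simp only [stCartan]
    split_ifs <;> first | ring1 | (exfalso; tauto)
  rw [Finset.sum_congr rfl (fun i _ => hz i), Finset.sum_add_distrib, Finset.sum_ite_eq',
    Finset.sum_ite_eq', if_pos (Finset.mem_univ _), if_pos (Finset.mem_univ _)]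

end ElasticData

/-! ### Weighted sums and insertions as profiles -/

namespace StretchingNotation

variable {V : Type*} [Fintype V] [DecidableEq V] {M : CoxeterMatrix V} {E : ElasticData M}
variable (A : Matrix V V ℤ)

/-- The vertex `x_lo` sits at position `lo + 1`, so its left neighbour, or the left weight if `lo =
0`, sits at position `lo`. -/
theorem leftSum_eq (β : StretchingNotation E) : β.leftSum A = E.profile A β.val β.lo := by
  classical
  rw [leftSum, Finset.sum_filter, Fintype.sum_sum_type]
  by_cases h : β.lo = 0
  · rw [h, Fin.val_zero, ElasticData.profile_zero, ElasticData.leftWeight]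
    have : ∑ i : Fin (β.m + 1), (if E.IsLeftNeighbor (0 : Fin (β.m + 1)) (Sum.inr i) then
        -E.stCartan A β.m (Sum.inr 0) (Sum.inr i) * β.val (Sum.inr i) else 0) = 0 :=
      Finset.sum_eq_zero fun i _ => if_neg (by simp [ElasticData.IsLeftNeighbor])
    rw [this, add_zero]
    refine Finset.sum_congr rfl fun z _ => ?_
    by_cases hz : z.1 ∈ E.left <;> simp [ElasticData.IsLeftNeighbor, ElasticData.stCartan, hz]
  · have h' : (β.lo : ℕ) ≠ 0 := fun h0 => h (Fin.ext h0)
    have : ∑ z : {v : V // v ≠ E.x}, (if E.IsLeftNeighbor β.lo (Sum.inl z) then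
        -E.stCartan A β.m (Sum.inr β.lo) (Sum.inl z) * β.val (Sum.inl z) else 0) = 0 :=
      Finset.sum_eq_zero fun i _ => if_neg (by simp [ElasticData.IsLeftNeighbor, h])
    rw [this, zero_add, Finset.sum_eq_single (⟨β.lo - 1, by omega⟩ : Fin (β.m + 1))]
    · rw [if_pos (by simp [ElasticData.IsLeftNeighbor]; omega), ElasticData.profile, if_neg h',
        dif_pos (by omega)]
      simp only [ElasticData.stCartan, Fin.ext_iff]
      rw [if_neg (by omega), if_pos (by omega)]
      ring
    · intro i _ hi
      refine if_neg fun h2 => hi (Fin.ext ?_)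
      simp only [ElasticData.IsLeftNeighbor] at h2
      simp
      omega
    · simp

theorem rightSum_eq (β : StretchingNotation E) :
    β.rightSum A = E.profile A β.val (β.hi + 2) := by
  classical
  rw [rightSum, Finset.sum_filter, Fintype.sum_sum_type]
  by_cases h : β.hi = Fin.last β.m
  · rw [h, ElasticData.profile_of_le E A β.val (by simp), ElasticData.rightWeight]
    have : ∑ i : Fin (β.m + 1), (if E.IsRightNeighbor (Fin.last β.m) (Sum.inr i) then
        -E.stCartan A β.m (Sum.inr (Fin.last β.m)) (Sum.inr i) * β.val (Sum.inr i) else 0) = 0 :=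
      Finset.sum_eq_zero fun i _ => if_neg (by
        have := i.2
        simp [ElasticData.IsRightNeighbor]
        omega)
    rw [this, add_zero]
    refine Finset.sum_congr rfl fun z _ => ?_
    by_cases hz : z.1 ∈ E.right <;> simp [ElasticData.IsRightNeighbor, ElasticData.stCartan, hz]
  · have h' : (β.hi : ℕ) < β.m := by
      have := Fin.val_lt_last h
      simpa using this
    have : ∑ z : {v : V // v ≠ E.x}, (if E.IsRightNeighbor β.hi (Sum.inl z) then
        -E.stCartan A β.m (Sum.inr β.hi) (Sum.inl z) * β.val (Sum.inl z) else 0) = 0 :=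
      Finset.sum_eq_zero fun i _ => if_neg (by simp [ElasticData.IsRightNeighbor, h])
    rw [this, zero_add, Finset.sum_eq_single (⟨β.hi + 1, by omega⟩ : Fin (β.m + 1))]
    · rw [if_pos (by simp [ElasticData.IsRightNeighbor]), ElasticData.profile,
        if_neg (by omega), dif_pos (by omega)]
      simp only [ElasticData.stCartan, Fin.ext_iff]
      rw [if_neg (by simp), if_pos (by simp)]
      simp
    · intro i _ hi
      refine if_neg fun h2 => hi (Fin.ext ?_)
      simp only [ElasticData.IsRightNeighbor] at h2
      simp
      omega
    · simp

theorem profile_insertNth {m : ℕ} (val : E.Vertex m → ℤ) (t : Fin (m + 2)) (c : ℤ) (k : ℕ) :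
    E.profile A (n := m + 1) (Sum.elim (fun v => val (Sum.inl v))
      (Fin.insertNth (α := fun _ => ℤ) t c (fun i => val (Sum.inr i)))) k =
      if k ≤ t then E.profile A val k else if k = t + 1 then c else E.profile A val (k - 1) := by
  have ht := t.2
  rcases Nat.eq_zero_or_pos k with rfl | hk
  · simp [ElasticData.profile_zero]
  by_cases hk2 : m + 3 ≤ k
  · rw [ElasticData.profile_of_le E A _ hk2, if_neg (by omega), if_neg (by omega),
      ElasticData.profile_of_le E A _ (by omega)]
    rfl
  obtain ⟨i, rfl⟩ : ∃ i : Fin (m + 2), k = i + 1 := ⟨⟨k - 1, by omega⟩, by simp; omega⟩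
  rw [ElasticData.profile_succ]
  simp only [Sum.elim_inr]
  split_ifs with h1 h2
  · have : i = t.succAbove ⟨i, by omega⟩ := by
      rw [Fin.succAbove_of_castSucc_lt _ _ (by rw [Fin.lt_def]; simp; omega)]
      rfl
    rw [this, Fin.insertNth_apply_succAbove, ← ElasticData.profile_succ E A val, ← this]
  · have : i = t := Fin.ext (by omega)
    rw [this, Fin.insertNth_apply_same]
  · have : i = t.succAbove ⟨i - 1, by omega⟩ := by
      rw [Fin.succAbove_of_le_castSucc _ _ (by rw [Fin.le_def]; simp; omega)]
      ext
      simp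
      omega
    rw [this, Fin.insertNth_apply_succAbove, ← ElasticData.profile_succ E A val]
    congr 1
    simp only
    omega

end StretchingNotation

/-! ### Stretching maps on positions -/

/-- A monotone map from the positions `0, …, n + 2` onto the positions `0, …, m + 2`, fixing both
ends, which only repeats the values in `(lo, hi + 1]`. -/
structure IsStretchMap (lo hi m n : ℕ) (Φ : ℕ → ℕ) : Prop where
  zero : Φ 0 = 0
  last : Φ (n + 2) = m + 2
  step : ∀ k < n + 2, Φ (k + 1) = Φ k + 1 ∨ (Φ (k + 1) = Φ k ∧ lo < Φ k ∧ Φ k ≤ hi + 1)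

namespace IsStretchMap

variable {lo hi m n : ℕ} {Φ : ℕ → ℕ}

theorem mono (h : IsStretchMap lo hi m n Φ) {k l : ℕ} (hkl : k ≤ l) (hl : l ≤ n + 2) :
    Φ k ≤ Φ l := by
  induction l, hkl using Nat.le_induction with
  | base => exact le_rfl
  | succ l _ ih =>
    have := ih (by omega)
    have := h.step l (by omega)
    omega

/-- The last position with value at most `i` works, since `Φ` rises by at most one at a time. It is
the right end of block `i`, and the next position starts block `i + 1`. -/
theorem exists_step (h : IsStretchMap lo hi m n Φ) {i : ℕ} (hi' : i ≤ m + 1) :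
    ∃ j ≤ n + 1, Φ j = i ∧ Φ (j + 1) = i + 1 := by
  have h0 : Φ (Nat.findGreatest (fun k => Φ k ≤ i) (n + 2)) ≤ i :=
    Nat.findGreatest_spec (P := fun k => Φ k ≤ i) (Nat.zero_le _) (by simp [h.zero])
  set j := Nat.findGreatest (fun k => Φ k ≤ i) (n + 2) with hj
  have hj2 : j ≤ n + 2 := Nat.findGreatest_le _
  have hj3 : j ≠ n + 2 := by
    intro he
    rw [he, h.last] at h0
    omega
  have h1 : ¬ Φ (j + 1) ≤ i :=
    Nat.findGreatest_is_greatest (P := fun k => Φ k ≤ i) (n := n + 2) (k := j + 1)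
      (by omega) (by omega)
  have := h.step j (by omega)
  exact ⟨j, by omega, by omega, by omega⟩

theorem eq_of_single (h : IsStretchMap lo hi m n Φ) {i j k : ℕ} (hj : j ≤ n) (h0 : Φ j = i)
    (h2 : Φ (j + 2) = i + 2) (hk : k ≤ n + 2) (hki : Φ k = i + 1) : k = j + 1 := by
  by_contra hne
  rcases Nat.lt_or_gt_of_ne hne with hlt | hlt
  · have := h.mono (Nat.lt_succ_iff.1 hlt) (by omega)
    omega
  · have := h.mono (show j + 2 ≤ k from hlt) hk
    omega

theorem pos (h : IsStretchMap lo hi m n Φ) (hh : hi ≤ m) {k : ℕ} (hk : 1 ≤ k) (hk' : k ≤ n + 1) :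
    1 ≤ Φ k ∧ Φ k ≤ m + 1 := by
  have h0 := h.zero
  have h1 := h.step 0 (by omega)
  have h2 := h.step (n + 1) (by omega)
  have h3 := h.last
  have h4 := h.mono hk (by omega)
  have h5 := h.mono hk' (by omega)
  simp only [Nat.zero_add] at h1
  have : n + 1 + 1 = n + 2 := rfl
  rw [this] at h2
  omega

theorem single_of_unmarked (h : IsStretchMap lo hi m n Φ) {i : ℕ} (hi' : i ≤ m)
    (hu : i < lo ∨ hi < i) : ∃ j ≤ n, Φ j = i ∧ Φ (j + 1) = i + 1 ∧ Φ (j + 2) = i + 2 := by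
  obtain ⟨j, hj, h0, h1⟩ := h.exists_step (i := i) (by omega)
  have hj' : j ≠ n + 1 := by
    rintro rfl
    have h3 := h.last
    have : n + 1 + 1 = n + 2 := rfl
    rw [this] at h1
    omega
  have h2 := h.step (j + 1) (by omega)
  refine ⟨j, by omega, h0, h1, ?_⟩
  have : j + 1 + 1 = j + 2 := rfl
  rw [this] at h2
  omega

theorem of_le (h : IsStretchMap lo hi m n Φ) {lo' hi' : ℕ} (hlo : lo' ≤ lo) (hhi : hi ≤ hi') :
    IsStretchMap lo' hi' m n Φ :=
  ⟨h.zero, h.last, fun k hk => by have := h.step k hk; omega⟩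

/-- Asterisks may be removed where a value is taken only once. -/
theorem dropLeft (h : IsStretchMap lo hi m n Φ) {j : ℕ} (hj : j ≤ n) (h0 : Φ j = lo)
    (h2 : Φ (j + 2) = lo + 2) : IsStretchMap (lo + 1) hi m n Φ :=
  ⟨h.zero, h.last, fun k hk => by
    have h3 := h.step k hk
    by_cases hk' : Φ k = lo + 1
    · have := h.eq_of_single hj h0 h2 hk.le hk'
      subst this
      have : j + 1 + 1 = j + 2 := rfl
      rw [this] at h3 ⊢
      omega
    · omega⟩

theorem dropRight {hi' : ℕ} (h : IsStretchMap lo hi m n Φ) {j : ℕ} (hj : j ≤ n) (h0 : Φ j = hi)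
    (h2 : Φ (j + 2) = hi + 2) (hh : hi' + 1 = hi) : IsStretchMap lo hi' m n Φ :=
  ⟨h.zero, h.last, fun k hk => by
    have h3 := h.step k hk
    by_cases hk' : Φ k = hi + 1
    · have := h.eq_of_single hj h0 h2 hk.le hk'
      subst this
      have : j + 1 + 1 = j + 2 := rfl
      rw [this] at h3 ⊢
      omega
    · omega⟩

/-- The last of at least two places of block `i + 1` passes to block `i + 2`. The bounds on `i` say
that both blocks carry an asterisk, so their lengths are free. -/
theorem shiftRight (h : IsStretchMap lo hi m n Φ) {i j : ℕ} (hj : j ≤ n) (h0 : Φ j = i + 1)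
    (h1 : Φ (j + 1) = i + 1) (h2 : Φ (j + 2) = i + 2) (hlo : lo ≤ i) (hhi : i < hi) :
    IsStretchMap lo hi m n (Function.update Φ (j + 1) (i + 2)) := by
  refine ⟨?_, ?_, fun k hk => ?_⟩
  · rw [Function.update_of_ne (by omega), h.zero]
  · rw [Function.update_of_ne (by omega), h.last]
  · have h3 := h.step k hk
    simp only [Function.update_apply]
    split_ifs with h4 h5 h5
    · omega
    · obtain rfl : k = j := by omega
      omega
    · subst h5
      have : j + 1 + 1 = j + 2 := rfl
      rw [this] at h3 ⊢
      omega
    · omega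

theorem shiftLeft (h : IsStretchMap lo hi m n Φ) {i j : ℕ} (hj : j ≤ n) (h0 : Φ j = i)
    (h1 : Φ (j + 1) = i + 1) (h2 : Φ (j + 2) = i + 1) (hlo : lo < i) (hhi : i ≤ hi) :
    IsStretchMap lo hi m n (Function.update Φ (j + 1) i) := by
  refine ⟨?_, ?_, fun k hk => ?_⟩
  · rw [Function.update_of_ne (by omega), h.zero]
  · rw [Function.update_of_ne (by omega), h.last]
  · have h3 := h.step k hk
    simp only [Function.update_apply]
    split_ifs with h4 h5 h5
    · omega
    · obtain rfl : k = j := by omega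
      omega
    · subst h5
      have : j + 1 + 1 = j + 2 := rfl
      rw [this] at h3 ⊢
      omega
    · omega

/-- If the only repeatable value is taken once, `dropLeft` leaves the empty range `(lo + 1, lo + 1]`
of repeatable values, and `Φ` is the identity. This is the exceptional case behind the bound `n₀ +
1`. -/
theorem eq_of_lo_eq_hi (h : IsStretchMap lo lo m n Φ) {j : ℕ} (hj : j ≤ n) (h0 : Φ j = lo)
    (h2 : Φ (j + 2) = lo + 2) : n = m := by
  have h' := h.dropLeft hj h0 h2
  have : ∀ k ≤ n + 2, Φ k = k := by
    intro k
    induction k with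
    | zero => exact fun _ => h.zero
    | succ k ih =>
      intro hk
      have := ih (by omega)
      have := h'.step k (by omega)
      omega
  have := this (n + 2) le_rfl
  have := h.last
  omega

/-- Block `i` is cut between `j` and `j + 1`, and everything after the cut is renumbered. Cutting
off the first or the last place gives the left or the right insertion; `collapseAt` undoes the cut.
-/
theorem insertAt (h : IsStretchMap lo hi m n Φ) {i j : ℕ} (hj : j ≤ n + 1) (h1 : Φ j = i)
    (h2 : Φ (j + 1) = i) (hi0 : lo < i) (hi1 : i ≤ hi + 1) :
    IsStretchMap lo (hi + 1) (m + 1) n (fun k => if k ≤ j then Φ k else Φ k + 1) := by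
  refine ⟨?_, ?_, fun k hk => ?_⟩
  · simp [h.zero]
  · simp only [h.last]
    rw [if_neg (by omega)]
  · have h3 := h.step k hk
    split_ifs with h4 h5 h5
    · omega
    · omega
    · obtain rfl : k = j := by omega
      omega
    · have := h.mono (show j ≤ k by omega) (by omega)
      omega

theorem collapseAt (h : IsStretchMap lo (hi + 1) (m + 1) n Φ) {i j : ℕ} (hj : j ≤ n + 1)
    (h1 : Φ j = i) (h2 : Φ (j + 1) = i + 1) (hi0 : lo < i) (hi1 : i ≤ hi + 1) :
    IsStretchMap lo hi m n (fun k => if k ≤ j then Φ k else Φ k - 1) := by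
  refine ⟨?_, ?_, fun k hk => ?_⟩
  · simp [h.zero]
  · simp only [h.last]
    rw [if_neg (by omega)]
    omega
  · have h3 := h.step k hk
    split_ifs with h4 h5 h5
    · have := h.mono h4 (by omega)
      omega
    · omega
    · obtain rfl : k = j := by omega
      omega
    · have := h.mono (show j + 1 ≤ k by omega) (by omega)
      omega

end IsStretchMap

/-! ### Functions represented by a notation -/

namespace ElasticData

variable {V : Type*} [Fintype V] [DecidableEq V] {M : CoxeterMatrix V} {E : ElasticData M}

/-- `g` arises from the notation `val`, with asterisks in positions `lo, …, hi` of the path, by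
the stretching map `Φ`. -/
structure Represents (A : Matrix V V ℤ) {m n : ℕ} (lo hi : ℕ) (val : E.Vertex m → ℤ)
    (g : E.Vertex n → ℤ) (Φ : ℕ → ℕ) : Prop where
  map : IsStretchMap lo hi m n Φ
  inl : ∀ v, g (Sum.inl v) = val (Sum.inl v)
  profile : ∀ k ≤ n + 2, E.profile A g k = E.profile A val (Φ k)

namespace Represents

variable {A : Matrix V V ℤ} {m n lo hi : ℕ} {val : E.Vertex m → ℤ} {g : E.Vertex n → ℤ}
  {Φ : ℕ → ℕ}

/-- A map `Φ` cannot repeat `0` or `m + 2`, so the path ends of `g` and `val` carry the same values.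
Hence the reflections off the path agree, and with them the two weights at the ends of the profiles.
-/
theorem reflect_inl (h : Represents A lo hi val g Φ) (hh : hi ≤ m) (z : {v : V // v ≠ E.x}) :
    Represents A lo hi (simpleReflection (E.stCartan A m) (Sum.inl z) val)
      (simpleReflection (E.stCartan A n) (Sum.inl z) g) Φ := by
  have hinl : ∀ v, simpleReflection (E.stCartan A n) (Sum.inl z) g (Sum.inl v) =
      simpleReflection (E.stCartan A m) (Sum.inl z) val (Sum.inl v) := by
    intro v
    by_cases hv : v = z
    · subst hv
      have e0 : g (Sum.inr 0) = val (Sum.inr 0) := by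
        have h1 := h.profile 1 (by omega)
        have h2 : Φ 1 = 1 := by
          have := h.map.step 0 (by omega)
          have := h.map.zero
          simp only [Nat.zero_add] at *
          omega
        rw [h2] at h1
        exact (profile_succ E A g 0).symm.trans (h1.trans (profile_succ E A val 0))
      have e1 : g (Sum.inr (Fin.last n)) = val (Sum.inr (Fin.last m)) := by
        have h1 := h.profile (n + 1) (by omega)
        have h2 : Φ (n + 1) = m + 1 := by
          have h3 := h.map.step (n + 1) (by omega)
          have h4 := h.map.last
          have : n + 1 + 1 = n + 2 := rfl
          rw [this] at h3
          omega
        rw [h2] at h1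
        exact (profile_succ E A g (Fin.last n)).symm.trans
          (h1.trans (profile_succ E A val (Fin.last m)))
      rw [simpleReflection_self, simpleReflection_self, sum_stCartan_inl, sum_stCartan_inl, e0,
        e1, h.inl]
      simp only [h.inl]
    · rw [simpleReflection_of_ne _ (by simpa using hv), simpleReflection_of_ne _ (by simpa using hv),
        h.inl]
  refine ⟨h.map, hinl, fun k hk => ?_⟩
  rcases Nat.eq_zero_or_pos k with rfl | hk0
  · rw [h.map.zero]
    exact (profile_congr E A hinl).1
  rcases Nat.lt_or_ge k (n + 2) with hk1 | hk1
  · have h1 := h.map.pos hh hk0 (by omega)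
    have h2 := h.profile k hk
    obtain ⟨i, rfl⟩ : ∃ i : Fin (n + 1), k = i + 1 := ⟨⟨k - 1, by omega⟩, by simp; omega⟩
    obtain ⟨i', hi'⟩ : ∃ i' : Fin (m + 1), Φ (i + 1) = i' + 1 :=
      ⟨⟨Φ (i + 1) - 1, by omega⟩, by simp; omega⟩
    rw [hi', profile_succ, profile_succ] at h2
    rw [hi', profile_succ, profile_succ, simpleReflection_inl_inr, simpleReflection_inl_inr, h2]
  · obtain rfl : k = n + 2 := by omega
    rw [h.map.last]
    exact (profile_congr E A hinl).2

/-- A reflection of the stretched function at a value which is taken once is a reflection of the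
notation. -/
theorem reflect_inr (h : Represents A lo hi val g Φ) {i : Fin (m + 1)} {j : Fin (n + 1)}
    (h0 : Φ j = i) (h1 : Φ (j + 1) = i + 1) (h2 : Φ (j + 2) = i + 2) :
    Represents A lo hi (simpleReflection (E.stCartan A m) (Sum.inr i) val)
      (simpleReflection (E.stCartan A n) (Sum.inr j) g) Φ := by
  refine ⟨h.map, fun v => ?_, fun k hk => ?_⟩
  · rw [simpleReflection_inr_inl, simpleReflection_inr_inl, h.inl]
  · rw [profile_simpleReflection_inr, profile_simpleReflection_inr]
    by_cases hkj : k = j + 1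
    · subst hkj
      rw [if_pos rfl, if_pos h1, h.profile _ (by omega), h.profile _ (by omega),
        h.profile _ (by omega), h0, h1, h2]
    · rw [if_neg hkj, if_neg (fun he => hkj (h.map.eq_of_single (by omega) h0 h2 hk he)),
        h.profile _ hk]

theorem simpleReflection_inr_self (h : Represents A lo hi val g Φ) (j : Fin (n + 1)) :
    simpleReflection (E.stCartan A n) (Sum.inr j) g (Sum.inr j) =
      E.profile A val (Φ j) + E.profile A val (Φ (j + 2)) - E.profile A val (Φ (j + 1)) := by
  rw [ElasticData.simpleReflection_inr_self, h.profile _ (by omega), h.profile _ (by omega),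
    h.profile _ (by omega)]

theorem apply_inr (h : Represents A lo hi val g Φ) (j : Fin (n + 1)) :
    g (Sum.inr j) = E.profile A val (Φ (j + 1)) := by
  rw [← profile_succ E A g, h.profile _ (by omega)]

/-- Moving the end of a block to the left. -/
theorem shiftRight (h : Represents A lo hi val g Φ) {i : ℕ} {j : Fin (n + 1)}
    (h0 : Φ j = i + 1) (h1 : Φ (j + 1) = i + 1) (h2 : Φ (j + 2) = i + 2) (hlo : lo ≤ i)
    (hhi : i < hi) :
    Represents A lo hi val (simpleReflection (E.stCartan A n) (Sum.inr j) g)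
      (Function.update Φ (j + 1) (i + 2)) := by
  refine ⟨h.map.shiftRight (by omega) h0 h1 h2 hlo hhi, fun v => ?_, fun k hk => ?_⟩
  · rw [simpleReflection_inr_inl, h.inl]
  · rw [profile_simpleReflection_inr, Function.update_apply]
    split_ifs with hkj
    · rw [h.profile _ (by omega), h.profile _ (by omega), h.profile _ (by omega), h0, h1, h2]
      ring
    · exact h.profile _ hk

/-- Moving the start of a block to the right. -/
theorem shiftLeft (h : Represents A lo hi val g Φ) {i : ℕ} {j : Fin (n + 1)}
    (h0 : Φ j = i) (h1 : Φ (j + 1) = i + 1) (h2 : Φ (j + 2) = i + 1) (hlo : lo < i)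
    (hhi : i ≤ hi) :
    Represents A lo hi val (simpleReflection (E.stCartan A n) (Sum.inr j) g)
      (Function.update Φ (j + 1) i) := by
  refine ⟨h.map.shiftLeft (by omega) h0 h1 h2 hlo hhi, fun v => ?_, fun k hk => ?_⟩
  · rw [simpleReflection_inr_inl, h.inl]
  · rw [profile_simpleReflection_inr, Function.update_apply]
    split_ifs with hkj
    · rw [h.profile _ (by omega), h.profile _ (by omega), h.profile _ (by omega), h0, h1, h2]
      ring
    · exact h.profile _ hk

theorem nonneg (h : Represents A lo hi val g Φ) (hh : hi ≤ m) (hv : ∀ v, 0 ≤ val v) :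
    ∀ v, 0 ≤ g v := by
  rintro (v | j)
  · rw [h.inl]
    exact hv _
  · have := h.map.pos hh (show 1 ≤ (j : ℕ) + 1 by omega) (by omega)
    obtain ⟨i, hi'⟩ : ∃ i : Fin (m + 1), Φ (j + 1) = i + 1 :=
      ⟨⟨Φ (j + 1) - 1, by omega⟩, by simp; omega⟩
    rw [h.apply_inr, hi', profile_succ]
    exact hv _

theorem nonneg_val (h : Represents A lo hi val g Φ) (hg : ∀ v, 0 ≤ g v) : ∀ v, 0 ≤ val v := by
  rintro (v | i)
  · rw [← h.inl]
    exact hg _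
  · obtain ⟨j, hj, h1, h2⟩ := h.map.exists_step (i := i) (by omega)
    have hj' : j ≠ n + 1 := by
      rintro rfl
      have h3 := h.map.last
      have : n + 1 + 1 = n + 2 := rfl
      rw [this] at h2
      omega
    have := h.apply_inr ⟨j, by omega⟩
    simp only [h2, profile_succ] at this
    rw [← this]
    exact hg _

/-- To show that a set closed under nonnegative decreasing reflections contains all functions
represented by a notation, one block next to a larger asterisked value may be taken to be a
single value. -/
theorem mem_of_single_right {D : Set (E.Vertex n → ℤ)}
    (hD : ∀ (g : E.Vertex n → ℤ) v, simpleReflection (E.stCartan A n) v g ∈ D → (∀ k, 0 ≤ g k) →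
      g v < simpleReflection (E.stCartan A n) v g v → g ∈ D)
    (hval : ∀ v, 0 ≤ val v) (hh : hi ≤ m) {i : ℕ} (hlo : lo ≤ i) (hhi : i < hi)
    (hlt : E.profile A val (i + 1) < E.profile A val (i + 2))
    (hsingle : ∀ (g : E.Vertex n → ℤ) (Φ : ℕ → ℕ) (j : Fin (n + 1)), Represents A lo hi val g Φ →
      Φ j = i → Φ (j + 1) = i + 1 → Φ (j + 2) = i + 2 → g ∈ D)
    (h : Represents A lo hi val g Φ) : g ∈ D := by
  -- Here `s` is the last place of block `i`, and block `i + 1` has length `d + 1`.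
  have key : ∀ (d s : ℕ) (g : E.Vertex n → ℤ) (Φ : ℕ → ℕ), Represents A lo hi val g Φ →
      s + d ≤ n → Φ s = i → Φ (s + 1) = i + 1 → Φ (s + d + 1) = i + 1 → Φ (s + d + 2) = i + 2 →
      g ∈ D := by
    intro d
    induction d with
    | zero =>
      intro s g Φ h hs h0 h1 _ h2
      exact hsingle g Φ ⟨s, by omega⟩ h h0 h1 h2
    | succ d ih =>
      intro s g Φ h hs h0 h1 h2 h3
      have h4 : Φ (s + (d + 1)) = i + 1 := by
        have := h.map.mono (show s + 1 ≤ s + (d + 1) by omega) (by omega)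
        have := h.map.mono (show s + (d + 1) ≤ s + (d + 1) + 1 by omega) (by omega)
        omega
      have h' := h.shiftRight (j := ⟨s + (d + 1), by omega⟩) h4 h2 h3 hlo hhi
      -- Giving the last place of the block to the larger block on its right is an increasing
      -- reflection, and `D` is closed under going back down.
      refine hD g (Sum.inr ⟨s + (d + 1), by omega⟩) (ih s _ _ h' (by omega) ?_ ?_ ?_ ?_)
        (h.nonneg hh hval) ?_
      · rw [Function.update_of_ne (by simp only; omega), h0]
      · rw [Function.update_of_ne (by simp only; omega), h1]
      · rw [Function.update_of_ne (by simp)]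
        exact h4
      · rw [Function.update_apply, if_pos (by simp; omega)]
      · rw [h.simpleReflection_inr_self, h.apply_inr]
        simp only [h4, h2, h3]
        linarith
  obtain ⟨s, hs, h0, h1⟩ := h.map.exists_step (i := i) (by omega)
  obtain ⟨e, he, h2, h3⟩ := h.map.exists_step (i := i + 1) (by omega)
  have hse : s + 1 ≤ e := by
    by_contra hlt
    have := h.map.mono (show e ≤ s by omega) (by omega)
    omega
  obtain ⟨d, rfl⟩ := Nat.exists_eq_add_of_le hse
  have hn : s + d ≤ n := by omega
  rw [Nat.add_right_comm] at h2
  rw [show s + 1 + d + 1 = s + d + 2 by omega] at h3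
  exact key d s g Φ h hn h0 h1 h2 h3

/-- Mirror image of `mem_of_single_right`: the block is shortened from its left end, where it
adjoins a larger block. -/
theorem mem_of_single_left {D : Set (E.Vertex n → ℤ)}
    (hD : ∀ (g : E.Vertex n → ℤ) v, simpleReflection (E.stCartan A n) v g ∈ D → (∀ k, 0 ≤ g k) →
      g v < simpleReflection (E.stCartan A n) v g v → g ∈ D)
    (hval : ∀ v, 0 ≤ val v) (hh : hi ≤ m) {i : ℕ} (hlo : lo < i) (hhi : i ≤ hi)
    (hlt : E.profile A val (i + 1) < E.profile A val i)
    (hsingle : ∀ (g : E.Vertex n → ℤ) (Φ : ℕ → ℕ) (j : Fin (n + 1)), Represents A lo hi val g Φ →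
      Φ j = i → Φ (j + 1) = i + 1 → Φ (j + 2) = i + 2 → g ∈ D)
    (h : Represents A lo hi val g Φ) : g ∈ D := by
  have key : ∀ (d s : ℕ) (g : E.Vertex n → ℤ) (Φ : ℕ → ℕ), Represents A lo hi val g Φ →
      s + d ≤ n → Φ s = i → Φ (s + 1) = i + 1 → Φ (s + d + 1) = i + 1 → Φ (s + d + 2) = i + 2 →
      g ∈ D := by
    intro d
    induction d with
    | zero =>
      intro s g Φ h hs h0 h1 _ h2
      exact hsingle g Φ ⟨s, by omega⟩ h h0 h1 h2
    | succ d ih =>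
      intro s g Φ h hs h0 h1 h2 h3
      have h4 : Φ (s + 2) = i + 1 := by
        have := h.map.mono (show s + 1 ≤ s + 2 by omega) (by omega)
        have := h.map.mono (show s + 2 ≤ s + (d + 1) + 1 by omega) (by omega)
        omega
      have h' := h.shiftLeft (j := ⟨s, by omega⟩) h0 h1 h4 hlo hhi
      refine hD g (Sum.inr ⟨s, by omega⟩) (ih (s + 1) _ _ h' (by omega) ?_ ?_ ?_ ?_)
        (h.nonneg hh hval) ?_
      · rw [Function.update_apply, if_pos rfl]
      · rw [Function.update_of_ne (by simp)]
        exact h4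
      · rw [Function.update_of_ne (by simp only; omega), show s + 1 + d + 1 = s + (d + 1) + 1 by omega,
          h2]
      · rw [Function.update_of_ne (by simp; omega), show s + 1 + d + 2 = s + (d + 1) + 2 by omega,
          h3]
      · rw [h.simpleReflection_inr_self, h.apply_inr]
        simp only [h4, h1, h0]
        linarith
  obtain ⟨s, hs, h0, h1⟩ := h.map.exists_step (i := i) (by omega)
  obtain ⟨e, he, h2, h3⟩ := h.map.exists_step (i := i + 1) (by omega)
  have hse : s + 1 ≤ e := by
    by_contra hlt
    have := h.map.mono (show e ≤ s by omega) (by omega)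
    omega
  obtain ⟨d, rfl⟩ := Nat.exists_eq_add_of_le hse
  have hn : s + d ≤ n := by omega
  rw [Nat.add_right_comm] at h2
  rw [show s + 1 + d + 1 = s + d + 2 by omega] at h3
  exact key d s g Φ h hn h0 h1 h2 h3

end Represents

end ElasticData

/-! ### Undoing reflections; insertions on representatives -/

namespace ElasticData.Represents

variable {V : Type*} [Fintype V] [DecidableEq V] {M : CoxeterMatrix V} {E : ElasticData M}
variable {A : Matrix V V ℤ} {m n lo hi : ℕ} {val : E.Vertex m → ℤ} {g : E.Vertex n → ℤ}
  {Φ : ℕ → ℕ}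

theorem unreflect_inr (hA : ∀ i, A i i = 2) {i : Fin (m + 1)} {j : Fin (n + 1)}
    (h : Represents A lo hi (simpleReflection (E.stCartan A m) (Sum.inr i) val) g Φ)
    (h0 : Φ j = i) (h1 : Φ (j + 1) = i + 1) (h2 : Φ (j + 2) = i + 2) :
    Represents A lo hi val (simpleReflection (E.stCartan A n) (Sum.inr j) g) Φ := by
  have := h.reflect_inr h0 h1 h2
  rwa [simpleReflection_simpleReflection _ (E.stCartan_self A hA _)] at this

theorem lt_of_unreflect_inr (hA : ∀ i, A i i = 2) {i : Fin (m + 1)} {j : Fin (n + 1)}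
    (h : Represents A lo hi (simpleReflection (E.stCartan A m) (Sum.inr i) val) g Φ)
    (h0 : Φ j = i) (h1 : Φ (j + 1) = i + 1) (h2 : Φ (j + 2) = i + 2)
    (hdec : simpleReflection (E.stCartan A m) (Sum.inr i) val (Sum.inr i) < val (Sum.inr i)) :
    g (Sum.inr j) < simpleReflection (E.stCartan A n) (Sum.inr j) g (Sum.inr j) := by
  rw [(h.unreflect_inr hA h0 h1 h2).apply_inr, h.apply_inr, h1, profile_succ, profile_succ]
  exact hdec

section Insert

variable {g : E.Vertex n → ℤ} {β : StretchingNotation E}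

/-- The first place of an endpoint block of length at least two equals its right neighbour, so
reflection turns it into the left neighbour, which is the weighted left sum. -/
theorem insertLeft (h : Represents A β.lo β.hi β.val g Φ) {j : Fin (n + 1)} (h0 : Φ j = β.lo)
    (h1 : Φ (j + 1) = β.lo + 1) (h2 : Φ (j + 2) = β.lo + 1) :
    Represents A (β.insertLeft (β.leftSum A)).lo (β.insertLeft (β.leftSum A)).hi
      (β.insertLeft (β.leftSum A)).val (simpleReflection (E.stCartan A n) (Sum.inr j) g)
      (fun k => if k ≤ j + 1 then Φ k else Φ k + 1) := by
  have hlh : (β.lo : ℕ) ≤ β.hi := β.lo_le_hi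
  refine ⟨?_, fun v => ?_, fun k hk => ?_⟩
  · exact h.map.insertAt (by omega) h1 h2 (by omega) (by omega)
  · rw [simpleReflection_inr_inl, h.inl]
    rfl
  · rw [profile_simpleReflection_inr]
    simp only [StretchingNotation.insertLeft, StretchingNotation.profile_insertNth,
      Fin.val_castSucc, StretchingNotation.leftSum_eq]
    rcases Nat.lt_trichotomy k (j + 1) with hkj | rfl | hkj
    · have := h.map.mono (show k ≤ j by omega) (by omega)
      rw [if_neg (by omega), if_pos (show k ≤ (j : ℕ) + 1 by omega), if_pos (by omega), h.profile _ hk]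
    · rw [if_pos rfl, if_pos le_rfl, if_neg (by omega), if_pos (by omega),
        h.profile _ (by omega), h.profile _ (by omega), h.profile _ (by omega), h0, h1, h2]
      ring
    · have := h.map.mono (show j + 1 ≤ k by omega) (by omega)
      rw [if_neg (by omega), if_neg (show ¬ k ≤ (j : ℕ) + 1 by omega), if_neg (by omega),
        if_neg (by omega),
        h.profile _ hk, Nat.add_sub_cancel]

theorem insertRight (h : Represents A β.lo β.hi β.val g Φ) {j : Fin (n + 1)}
    (h0 : Φ j = β.hi + 1) (h1 : Φ (j + 1) = β.hi + 1) (h2 : Φ (j + 2) = β.hi + 2) :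
    Represents A (β.insertRight (β.rightSum A)).lo (β.insertRight (β.rightSum A)).hi
      (β.insertRight (β.rightSum A)).val (simpleReflection (E.stCartan A n) (Sum.inr j) g)
      (fun k => if k ≤ j then Φ k else Φ k + 1) := by
  have hlh : (β.lo : ℕ) ≤ β.hi := β.lo_le_hi
  refine ⟨?_, fun v => ?_, fun k hk => ?_⟩
  · exact h.map.insertAt (by omega) h0 h1 (by omega) (by omega)
  · rw [simpleReflection_inr_inl, h.inl]
    rfl
  · rw [profile_simpleReflection_inr]
    simp only [StretchingNotation.insertRight, StretchingNotation.profile_insertNth,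
      Fin.val_succ, StretchingNotation.rightSum_eq]
    rcases Nat.lt_trichotomy k (j + 1) with hkj | rfl | hkj
    · have := h.map.mono (show k ≤ j by omega) (by omega)
      rw [if_neg (by omega), if_pos (show k ≤ (j : ℕ) by omega), if_pos (by omega), h.profile _ hk]
    · rw [if_pos rfl, if_neg (show ¬ (j : ℕ) + 1 ≤ j by omega), if_neg (by omega), if_pos (by omega),
        h.profile _ (by omega), h.profile _ (by omega), h.profile _ (by omega), h0, h1, h2]
      ring
    · have := h.map.mono (show j + 2 ≤ k by omega) (by omega)
      rw [if_neg (by omega), if_neg (show ¬ k ≤ (j : ℕ) by omega), if_neg (by omega),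
        if_neg (by omega),
        h.profile _ hk, Nat.add_sub_cancel]

/-- An inserted value taken once stands between an equal entry on its left and the old endpoint
value; reflection turns it into the latter and it joins that block. -/
theorem uninsertLeft (h : Represents A (β.insertLeft (β.leftSum A)).lo
      (β.insertLeft (β.leftSum A)).hi (β.insertLeft (β.leftSum A)).val g Φ) {j : Fin (n + 1)}
    (h0 : Φ j = β.lo) (h1 : Φ (j + 1) = β.lo + 1) (h2 : Φ (j + 2) = β.lo + 2) :
    Represents A β.lo β.hi β.val (simpleReflection (E.stCartan A n) (Sum.inr j) g)
      (fun k => if k ≤ j + 1 then Φ k else Φ k - 1) := by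
  have hlh : (β.lo : ℕ) ≤ β.hi := β.lo_le_hi
  have hmap : IsStretchMap β.lo (β.hi + 1) (β.m + 1) n Φ := h.map
  refine ⟨?_, fun v => ?_, fun k hk => ?_⟩
  · exact hmap.collapseAt (by omega) h1 h2 (by omega) (by omega)
  · rw [simpleReflection_inr_inl, h.inl]
    rfl
  · have hp := h.profile
    simp only [StretchingNotation.insertLeft, StretchingNotation.profile_insertNth,
      Fin.val_castSucc, StretchingNotation.leftSum_eq] at hp
    rw [profile_simpleReflection_inr]
    rcases Nat.lt_trichotomy k (j + 1) with hkj | rfl | hkj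
    · have := hmap.mono (show k ≤ j by omega) (by omega)
      rw [if_neg (by omega), if_pos (by omega), hp _ hk, if_pos (by omega)]
    · rw [if_pos rfl, if_pos le_rfl, hp _ (by omega), hp _ (by omega), hp _ (by omega), h0, h1, h2,
        if_pos le_rfl, if_neg (by omega), if_neg (by omega), if_neg (by omega), if_pos rfl]
      simp
    · have := hmap.mono (show j + 2 ≤ k by omega) (by omega)
      rw [if_neg (by omega), if_neg (by omega), hp _ hk, if_neg (by omega), if_neg (by omega)]

theorem uninsertRight (h : Represents A (β.insertRight (β.rightSum A)).lo
      (β.insertRight (β.rightSum A)).hi (β.insertRight (β.rightSum A)).val g Φ)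
    {j : Fin (n + 1)}
    (h0 : Φ j = β.hi + 1) (h1 : Φ (j + 1) = β.hi + 2) (h2 : Φ (j + 2) = β.hi + 3) :
    Represents A β.lo β.hi β.val (simpleReflection (E.stCartan A n) (Sum.inr j) g)
      (fun k => if k ≤ j then Φ k else Φ k - 1) := by
  have hlh : (β.lo : ℕ) ≤ β.hi := β.lo_le_hi
  have hmap : IsStretchMap β.lo (β.hi + 1) (β.m + 1) n Φ := h.map
  refine ⟨?_, fun v => ?_, fun k hk => ?_⟩
  · exact hmap.collapseAt (by omega) h0 h1 (by omega) (by omega)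
  · rw [simpleReflection_inr_inl, h.inl]
    rfl
  · have hp := h.profile
    simp only [StretchingNotation.insertRight, StretchingNotation.profile_insertNth,
      Fin.val_succ, StretchingNotation.rightSum_eq] at hp
    rw [profile_simpleReflection_inr]
    rcases Nat.lt_trichotomy k (j + 1) with hkj | rfl | hkj
    · have := hmap.mono (show k ≤ j by omega) (by omega)
      rw [if_neg (by omega), if_pos (by omega), hp _ hk, if_pos (by omega)]
    · rw [if_pos rfl, if_neg (by omega), hp _ (by omega), hp _ (by omega), hp _ (by omega), h0, h1,
        h2, if_pos le_rfl, if_neg (by omega), if_neg (by omega), if_neg (by omega), if_pos rfl]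
      simp
    · have := hmap.mono (show j + 2 ≤ k by omega) (by omega)
      rw [if_neg (by omega), if_neg (by omega), hp _ hk, if_neg (by omega), if_neg (by omega)]

end Insert

end ElasticData.Represents

/-! ### Slices and their behaviour under arrows -/

namespace StretchingNotation

variable {V : Type*} [Fintype V] [DecidableEq V] {M : CoxeterMatrix V} {E : ElasticData M}

/-- This trades the global conditions on a surjection of path vertices for step-by-step conditions
on positions, shifted by one and with the two weights as fixed ends. -/
theorem mem_slice_iff (A : Matrix V V ℤ) (β : StretchingNotation E) {n : ℕ}
    (g : E.Vertex n → ℤ) :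
    g ∈ β.slice n ↔ ∃ Φ, E.Represents A β.lo β.hi β.val g Φ := by
  have hlh : (β.lo : ℕ) ≤ β.hi := β.lo_le_hi
  constructor
  · rintro ⟨hinl, φ, hmono, hsurj, hinj, hval⟩
    have hφ : ∀ a b : Fin (n + 1), (a : ℕ) ≤ b → (φ a : ℕ) ≤ φ b := fun a b hab => hmono hab
    have hzero : (φ 0 : ℕ) = 0 := by
      obtain ⟨a, ha⟩ := hsurj 0
      have := hφ 0 a (by simp)
      rw [ha] at this
      simpa using this
    have hlast : (φ (Fin.last n) : ℕ) = β.m := by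
      obtain ⟨a, ha⟩ := hsurj (Fin.last _)
      have := hφ a (Fin.last n) (by simpa using a.is_le)
      rw [ha] at this
      have h2 := (φ (Fin.last n)).is_le
      simp at this
      omega
    -- Surjectivity and monotonicity forbid jumps, and a repeated value must carry an asterisk.
    have hstep : ∀ a b : Fin (n + 1), (a : ℕ) + 1 = b → (φ b : ℕ) = φ a + 1 ∨
        (φ b = φ a ∧ β.lo ≤ φ a ∧ φ a ≤ β.hi) := by
      intro a b hab
      have h1 := hφ a b (by omega)
      by_cases he : φ b = φ a
      · right
        refine ⟨he, ?_⟩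
        by_contra hne
        have := hinj a b he.symm hne
        subst this
        omega
      · left
        have hne : (φ b : ℕ) ≠ φ a := fun h => he (Fin.ext h)
        by_contra hne2
        obtain ⟨c, hc⟩ := hsurj ⟨φ a + 1, by omega⟩
        have hc' : (φ c : ℕ) = φ a + 1 := by rw [hc]
        rcases Nat.lt_or_ge a c with hac | hac
        · have := hφ b c (by omega)
          omega
        · have := hφ c a hac
          omega
    refine ⟨fun k => if k = 0 then 0 else if h : k - 1 < n + 1 then φ ⟨k - 1, h⟩ + 1
      else β.m + 2, ⟨⟨by simp, by simp, fun k hk => ?_⟩, hinl, fun k hk => ?_⟩⟩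
    · rcases Nat.eq_zero_or_pos k with rfl | hk0
      · left
        simpa using hzero
      · rw [if_neg (by omega), if_neg (by omega), dif_pos (show k - 1 < n + 1 by omega)]
        rcases Nat.lt_or_ge k (n + 1) with hk1 | hk1
        · rw [dif_pos (show k + 1 - 1 < n + 1 by omega)]
          rcases hstep ⟨k - 1, by omega⟩ ⟨k + 1 - 1, by omega⟩ (by simp; omega) with h | ⟨h, h'⟩
          · left
            rw [h]
          · right
            rw [h]
            rw [Fin.le_def, Fin.le_def] at h'
            omega
        · rw [dif_neg (show ¬ k + 1 - 1 < n + 1 by omega)]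
          left
          have : (⟨k - 1, by omega⟩ : Fin (n + 1)) = Fin.last n := Fin.ext (by simp; omega)
          rw [this, hlast]
    · rcases Nat.eq_zero_or_pos k with rfl | hk0
      · rw [if_pos rfl]
        exact (ElasticData.profile_congr E A hinl).1
      · rw [if_neg (by omega)]
        rcases Nat.lt_or_ge k (n + 2) with hk1 | hk1
        · rw [dif_pos (show k - 1 < n + 1 by omega), ElasticData.profile_succ, ← hval,
            ← ElasticData.profile_succ E A g]
          congr 1
          simp only
          omega
        · obtain rfl : k = n + 2 := by omega
          rw [dif_neg (by omega)]
          exact (ElasticData.profile_congr E A hinl).2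
  · rintro ⟨Φ, h⟩
    have hpos : ∀ i : Fin (n + 1), 1 ≤ Φ (i + 1) ∧ Φ (i + 1) ≤ β.m + 1 := fun i =>
      h.map.pos (by omega) (by omega) (by omega)
    refine ⟨h.inl, fun i => ⟨Φ (i + 1) - 1, by have := hpos i; omega⟩, ?_, ?_, ?_, ?_⟩
    · intro a b hab
      have hab' : (a : ℕ) ≤ b := hab
      have := h.map.mono (show (a : ℕ) + 1 ≤ b + 1 by omega) (by omega)
      rw [Fin.le_def]
      simp only
      omega
    · intro i
      obtain ⟨j, hj, h1, h2⟩ := h.map.exists_step (i := i) (by omega)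
      have hj' : j ≠ n + 1 := by
        rintro rfl
        have h3 := h.map.last
        have : n + 1 + 1 = n + 2 := rfl
        rw [this] at h2
        omega
      exact ⟨⟨j, by omega⟩, Fin.ext (by simp [h2])⟩
    · intro a b hab hun
      have e : Φ (a + 1) = Φ (b + 1) := by
        have := Fin.ext_iff.1 hab
        have h1 := hpos a
        have h2 := hpos b
        simp only at this
        omega
      simp only [Asterisked, Fin.le_def] at hun
      have h1 := hpos a
      obtain ⟨j, hj, h2, -, h3⟩ := h.map.single_of_unmarked (i := Φ (a + 1) - 1) (by omega)
        (by omega)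
      have h4 := h.map.eq_of_single hj h2 h3 (k := a + 1) (by omega) (by omega)
      have h5 := h.map.eq_of_single hj h2 h3 (k := b + 1) (by omega) (by omega)
      exact Fin.ext (by omega)
    · intro i
      have h1 := hpos i
      rw [h.apply_inr, ← ElasticData.profile_succ E A β.val]
      congr 1
      simp only
      omega

/-- If a set is closed under nonnegative decreasing reflections and contains the functions of a
stretching class, then it also contains the functions of each class reached by an arrow. -/
theorem slice_subset_of_arrow {A : Matrix V V ℤ} (hA : ∀ i, A i i = 2) {n : ℕ}
    {D : Set (E.Vertex n → ℤ)}
    (hD : ∀ (g : E.Vertex n → ℤ) v, simpleReflection (E.stCartan A n) v g ∈ D → (∀ k, 0 ≤ g k) →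
      g v < simpleReflection (E.stCartan A n) v g v → g ∈ D)
    {β γ : StretchingNotation E} (hβ : β.slice n ⊆ D) (hβγ : Arrow A β γ) : γ.slice n ⊆ D := by
  have hβ' : ∀ g Φ, E.Represents A β.lo β.hi β.val g Φ → g ∈ D := fun g Φ h =>
    hβ ((mem_slice_iff A β g).2 ⟨Φ, h⟩)
  intro g hg
  obtain ⟨Φ, h⟩ := (mem_slice_iff A γ g).1 hg
  obtain ⟨hop, hγ⟩ := hβγ
  have hlh : (β.lo : ℕ) ≤ β.hi := β.lo_le_hi
  have hhm : (β.hi : ℕ) ≤ β.m := β.hi.is_le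
  have hgn : ∀ v, 0 ≤ g v := h.nonneg γ.hi.is_le hγ
  -- Common core of the reflection cases: if the reflected value is taken once, reflecting it back
  -- gives a larger function represented by `β`.
  have single : ∀ (g : E.Vertex n → ℤ) (Φ : ℕ → ℕ) (i : Fin (β.m + 1)) (j : Fin (n + 1)),
      E.Represents A β.lo β.hi (β.reflectVal A (Sum.inr i)) g Φ →
      β.reflectVal A (Sum.inr i) (Sum.inr i) < β.val (Sum.inr i) →
      (∀ v, 0 ≤ β.reflectVal A (Sum.inr i) v) →
      Φ j = i → Φ (j + 1) = i + 1 → Φ (j + 2) = i + 2 → g ∈ D := by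
    intro g Φ i j h hdec hnn h0 h1 h2
    exact hD g (Sum.inr j) (hβ' _ _ (h.unreflect_inr hA h0 h1 h2)) (h.nonneg hhm hnn)
      (h.lt_of_unreflect_inr hA h0 h1 h2 hdec)
  have hprof : ∀ (i : Fin (β.m + 1)) (k : ℕ),
      E.profile A (β.reflectVal A (Sum.inr i)) k =
      if k = i + 1 then E.profile A β.val i + E.profile A β.val (i + 2) -
        E.profile A β.val (i + 1) else E.profile A β.val k := fun i k =>
    ElasticData.profile_simpleReflection_inr E A β.val i k
  have hself : ∀ i : Fin (β.m + 1), β.reflectVal A (Sum.inr i) (Sum.inr i) =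
      E.profile A β.val i + E.profile A β.val (i + 2) - E.profile A β.val (i + 1) := fun i =>
    ElasticData.simpleReflection_inr_self E A β.val i
  cases hop with
  | unmarked v hv hdec =>
    rcases v with z | i
    · have h' := h.reflect_inl hhm z
      have hback : simpleReflection (E.stCartan A β.m) (Sum.inl z) (β.reflect A (Sum.inl z)).val =
          β.val := simpleReflection_simpleReflection _ (E.stCartan_self A hA _) _
      have h'' : E.Represents A β.lo β.hi β.val
          (simpleReflection (E.stCartan A n) (Sum.inl z) g) Φ := hback ▸ h'
      refine hD g (Sum.inl z) (hβ' _ _ h'') hgn ?_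
      rw [h''.inl, h.inl]
      exact hdec
    · simp only [Asterisked, Fin.le_def] at hv
      obtain ⟨j, hj, h0, h1, h2⟩ := h.map.single_of_unmarked i.is_le (show (i : ℕ) < β.lo ∨ _ by
        simp only [reflect]
        omega)
      exact single g Φ i ⟨j, by omega⟩ h hdec hγ h0 h1 h2
  | internal i hlo hhi hdec =>
    have hdec' := hdec
    rw [hself, ← ElasticData.profile_succ E A β.val] at hdec'
    -- A decrease means that the old value exceeds at least one neighbour strictly. If it exceeds
    -- the left one, the new value is below the right one; otherwise it is below the left one.
    by_cases hc : E.profile A β.val i < E.profile A β.val (i + 1)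
    · refine h.mem_of_single_right hD hγ hhm (i := i) hlo.le hhi ?_
        fun g Φ j h' => single g Φ i j h' hdec hγ
      change E.profile A (β.reflectVal A (Sum.inr i)) _ <
        E.profile A (β.reflectVal A (Sum.inr i)) _
      rw [hprof, hprof, if_pos rfl, if_neg (by omega)]
      linarith
    · refine h.mem_of_single_left hD hγ hhm (i := i) hlo hhi.le ?_
        fun g Φ j h' => single g Φ i j h' hdec hγ
      change E.profile A (β.reflectVal A (Sum.inr i)) _ <
        E.profile A (β.reflectVal A (Sum.inr i)) _
      rw [hprof, hprof, if_pos rfl, if_neg (by omega)]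
      linarith
  | insertLeft hlt =>
    rw [← ElasticData.profile_succ E A β.val] at hlt
    refine h.mem_of_single_right hD hγ (by simp [StretchingNotation.insertLeft]; omega)
      (i := β.lo) le_rfl (by simp [StretchingNotation.insertLeft]; omega) ?_ ?_
    · simp only [StretchingNotation.insertLeft, profile_insertNth, Fin.val_castSucc]
      rw [if_neg (by omega), if_pos trivial, if_neg (by omega), if_neg (by omega)]
      exact hlt
    · intro g Φ j h h0 h1 h2
      have h' := h.uninsertLeft h0 h1 h2
      refine hD g (Sum.inr j) (hβ' _ _ h') (h.nonneg (Fin.is_le _) hγ) ?_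
      rw [h'.apply_inr, h.apply_inr, if_pos le_rfl, h1]
      simp only [StretchingNotation.insertLeft, profile_insertNth, Fin.val_castSucc]
      rw [if_neg (by omega), if_pos trivial]
      exact hlt
  | insertRight hlt =>
    rw [← ElasticData.profile_succ E A β.val] at hlt
    refine h.mem_of_single_left hD hγ (by simp [StretchingNotation.insertRight]; omega)
      (i := β.hi + 1) (by simp [StretchingNotation.insertRight]; omega)
      (by simp [StretchingNotation.insertRight]) ?_ ?_
    · simp only [StretchingNotation.insertRight, profile_insertNth, Fin.val_succ]
      rw [if_neg (by omega), if_pos trivial, if_pos le_rfl]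
      exact hlt
    · intro g Φ j h h0 h1 h2
      have h' := h.uninsertRight h0 h1 h2
      refine hD g (Sum.inr j) (hβ' _ _ h') (h.nonneg (Fin.is_le _) hγ) ?_
      rw [h'.apply_inr, h.apply_inr, if_neg (by omega), h1]
      simp only [StretchingNotation.insertRight, profile_insertNth, Fin.val_succ]
      rw [if_neg (by omega), if_pos trivial]
      exact hlt
  | leftKeep k hk hkhi hdec hlt =>
    refine h.mem_of_single_right hD hγ hhm (i := β.lo) le_rfl
      (show (β.lo : ℕ) < β.hi by omega) ?_
        fun g Φ j h' => single g Φ β.lo j h' hdec hγ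
    change E.profile A (β.reflectVal A (Sum.inr β.lo)) _ <
        E.profile A (β.reflectVal A (Sum.inr β.lo)) _
    rw [ElasticData.profile_succ, hprof, if_neg (by omega), show (β.lo : ℕ) + 2 = k + 1 by omega,
      ElasticData.profile_succ]
    exact hlt
  | rightKeep k hk hklo hdec hlt =>
    refine h.mem_of_single_left hD hγ hhm (i := β.hi) 
      (show (β.lo : ℕ) < β.hi by omega) le_rfl ?_
        fun g Φ j h' => single g Φ β.hi j h' hdec hγ
    change E.profile A (β.reflectVal A (Sum.inr β.hi)) _ <
        E.profile A (β.reflectVal A (Sum.inr β.hi)) _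
    rw [ElasticData.profile_succ, hprof, if_neg (by omega), ← hk,
      ElasticData.profile_succ]
    exact hlt
  | leftDrop k hk hkhi hdec hge =>
    -- Having lost its asterisk, the value is taken once already, so no block has to be shortened.
    obtain ⟨j, hj, h0, h1, h2⟩ := h.map.single_of_unmarked (i := β.lo) β.lo.is_le
      (Or.inl (show (β.lo : ℕ) < k by omega))
    exact single g Φ β.lo ⟨j, by omega⟩
      ⟨h.map.of_le (show (β.lo : ℕ) ≤ k by omega) le_rfl, h.inl, h.profile⟩ hdec hγ h0 h1 h2
  | rightDrop k hk hklo hdec hge =>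
    obtain ⟨j, hj, h0, h1, h2⟩ := h.map.single_of_unmarked (i := β.hi) β.hi.is_le
      (Or.inr (show (k : ℕ) < β.hi by omega))
    exact single g Φ β.hi ⟨j, by omega⟩
      ⟨h.map.of_le le_rfl (show (k : ℕ) ≤ β.hi by omega), h.inl, h.profile⟩ hdec hγ h0 h1 h2

end StretchingNotation

/-! ### Existence of members and of operations -/

namespace StretchingNotation

section

variable {V : Type*} [DecidableEq V] {M : CoxeterMatrix V} {E : ElasticData M}

theorem mem_slice_star {α : V → ℤ} {n : ℕ} {g : E.Vertex n → ℤ} :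
    g ∈ (star E α).slice n ↔ g = E.stretch n α := by
  constructor
  · rintro ⟨h1, φ, -, -, -, h2⟩
    funext v
    rcases v with v | i
    · exact h1 v
    · exact h2 i
  · rintro rfl
    refine ⟨fun v => rfl, fun _ => 0, fun _ _ _ => le_rfl, fun i => ⟨0, ?_⟩, ?_, fun i => rfl⟩
    · exact Subsingleton.elim (α := Fin 1) _ _
    · intro i j _ h
      exact absurd ⟨le_rfl, le_rfl⟩ h

theorem le_of_slice_nonempty {β : StretchingNotation E} {n : ℕ} (h : (β.slice n).Nonempty) :
    β.m ≤ n := by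
  obtain ⟨g, -, φ, -, hφ, -⟩ := h
  have := Fintype.card_le_of_surjective φ hφ
  simpa using this

theorem slice_nonempty (β : StretchingNotation E) {n : ℕ} (h : β.m ≤ n) :
    (β.slice n).Nonempty := by
  have hlo := β.lo.is_le
  have hlh : (β.lo : ℕ) ≤ β.hi := β.lo_le_hi
  -- All `n - β.m` surplus copies go to the left endpoint.
  let φ : Fin (n + 1) → Fin (β.m + 1) := fun i =>
    ⟨if (i : ℕ) ≤ β.lo then i else max β.lo (i - (n - β.m)), by split_ifs <;> omega⟩
  have hφ : ∀ i, (φ i : ℕ) = if (i : ℕ) ≤ β.lo then (i : ℕ) else max β.lo (i - (n - β.m)) :=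
    fun i => rfl
  refine ⟨Sum.elim (fun v => β.val (Sum.inl v)) (fun i => β.val (Sum.inr (φ i))), fun v => rfl,
    φ, ?_, ?_, ?_, fun i => rfl⟩
  · intro i j hij
    rw [Fin.le_def] at hij ⊢
    rw [hφ, hφ]
    split_ifs <;> omega
  · intro i
    by_cases hi : (i : ℕ) ≤ β.lo
    · exact ⟨⟨i, by omega⟩, Fin.ext (by rw [hφ, if_pos hi])⟩
    · refine ⟨⟨i + (n - β.m), by omega⟩, Fin.ext ?_⟩
      rw [hφ, if_neg (by simp only; omega)]
      simp only
      omega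
  · intro i j hij hun
    have hij' := Fin.ext_iff.1 hij
    simp only [Asterisked, Fin.le_def] at hun
    rw [hφ] at hun
    rw [hφ, hφ] at hij'
    refine Fin.ext ?_
    split_ifs at hij' hun <;> omega

theorem insertLeft_val_lo (β : StretchingNotation E) (c : ℤ) :
    (β.insertLeft c).val (Sum.inr (β.insertLeft c).lo) = c := by
  simp [insertLeft]

theorem insertRight_val_hi (β : StretchingNotation E) (c : ℤ) :
    (β.insertRight c).val (Sum.inr (β.insertRight c).hi) = c := by
  simp [insertRight]

theorem insertLeft_val_succ (β : StretchingNotation E) (c : ℤ) (i : Fin (β.m + 1))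
    (hi : β.lo ≤ i) : (β.insertLeft c).val (Sum.inr i.succ) = β.val (Sum.inr i) := by
  have : i.succ = β.lo.castSucc.succAbove i :=
    (Fin.succAbove_of_le_castSucc _ _ (by simpa using hi)).symm
  simp only [insertLeft, Sum.elim_inr]
  rw [this, Fin.insertNth_apply_succAbove]

theorem insertRight_val_castSucc (β : StretchingNotation E) (c : ℤ) (i : Fin (β.m + 1))
    (hi : i ≤ β.hi) : (β.insertRight c).val (Sum.inr i.castSucc) = β.val (Sum.inr i) := by
  have : i.castSucc = β.hi.succ.succAbove i :=
    (Fin.succAbove_of_castSucc_lt _ _ (by rw [Fin.lt_def]; rw [Fin.le_def] at hi; simp; omega)).symm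
  simp only [insertRight, Sum.elim_inr]
  rw [this, Fin.insertNth_apply_succAbove]

theorem insertLeft_val_cases (β : StretchingNotation E) (c : ℤ) (v : E.Vertex (β.m + 1)) :
    (β.insertLeft c).val v = c ∨ ∃ w, (β.insertLeft c).val v = β.val w := by
  rcases v with v | i
  · exact Or.inr ⟨Sum.inl v, rfl⟩
  · simp only [insertLeft, Sum.elim_inr]
    rcases Fin.eq_self_or_eq_succAbove β.lo.castSucc i with h | ⟨k, h⟩
    · left
      rw [h, Fin.insertNth_apply_same]
    · right
      exact ⟨Sum.inr k, by rw [h, Fin.insertNth_apply_succAbove]⟩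

theorem insertRight_val_cases (β : StretchingNotation E) (c : ℤ) (v : E.Vertex (β.m + 1)) :
    (β.insertRight c).val v = c ∨ ∃ w, (β.insertRight c).val v = β.val w := by
  rcases v with v | i
  · exact Or.inr ⟨Sum.inl v, rfl⟩
  · simp only [insertRight, Sum.elim_inr]
    rcases Fin.eq_self_or_eq_succAbove β.hi.succ i with h | ⟨k, h⟩
    · left
      rw [h, Fin.insertNth_apply_same]
    · right
      exact ⟨Sum.inr k, by rw [h, Fin.insertNth_apply_succAbove]⟩

end

variable {V : Type*} [Fintype V] [DecidableEq V] {M : CoxeterMatrix V} {E : ElasticData M}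

/-- A decreasing reflection of a function in a stretching class stays in this class or leads to a
class that is obtained by an operation. -/
theorem exists_operation {A : Matrix V V ℤ} {β : StretchingNotation E} {n : ℕ}
    (hn : β.SingleAsterisk → n ≠ β.m) {g : E.Vertex n → ℤ} (hg : g ∈ β.slice n) (v : E.Vertex n)
    (hlt : simpleReflection (E.stCartan A n) v g v < g v) :
    ∃ γ, (γ = β ∨ Operation A β γ) ∧ simpleReflection (E.stCartan A n) v g ∈ γ.slice n := by
  suffices ∃ γ, (γ = β ∨ Operation A β γ) ∧
      ∃ Φ, E.Represents A γ.lo γ.hi γ.val (simpleReflection (E.stCartan A n) v g) Φ by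
    obtain ⟨γ, h1, h2⟩ := this
    exact ⟨γ, h1, (mem_slice_iff A γ _).2 h2⟩
  obtain ⟨Φ, h⟩ := (mem_slice_iff A β g).1 hg
  have hlh : (β.lo : ℕ) ≤ β.hi := β.lo_le_hi
  have hhm : (β.hi : ℕ) ≤ β.m := β.hi.is_le
  rcases v with z | j
  · have h' := h.reflect_inl hhm z
    rw [h'.inl, h.inl] at hlt
    exact ⟨β.reflect A (Sum.inl z), Or.inr (.unmarked β _ (by simp [Asterisked]) hlt), Φ, h'⟩
  have hpos := h.map.pos hhm (show 1 ≤ (j : ℕ) + 1 by omega) (by omega)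
  obtain ⟨i, h1⟩ : ∃ i : Fin (β.m + 1), Φ (j + 1) = i + 1 :=
    ⟨⟨Φ (j + 1) - 1, by omega⟩, by simp; omega⟩
  have hs0 := h.map.step j (by omega)
  have hs1 : Φ (j + 2) = Φ (j + 1) + 1 ∨
      (Φ (j + 2) = Φ (j + 1) ∧ β.lo < Φ (j + 1) ∧ Φ (j + 1) ≤ β.hi + 1) :=
    h.map.step (j + 1) (by omega)
  have hlt' := hlt
  rw [h.simpleReflection_inr_self, h.apply_inr] at hlt'
  rcases Nat.lt_or_ge (Φ j) (i + 1) with h0 | h0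
  · replace h0 : Φ j = i := by omega
    rcases Nat.lt_or_ge (Φ (j + 2)) (i + 2) with h2 | h2
    · -- the start of a block of length at least two
      replace h2 : Φ (j + 2) = i + 1 := by omega
      -- If an asterisked block lies to the left, the reflection only moves the edge between the two
      -- blocks; at the left endpoint it is an insertion.
      rcases Nat.lt_or_ge β.lo i with hi | hi
      · exact ⟨β, Or.inl rfl, _, h.shiftLeft h0 h1 h2 hi (by omega)⟩
      · obtain rfl : i = β.lo := Fin.ext (by omega)
        rw [h0, h1, h2, ElasticData.profile_succ, ← leftSum_eq] at hlt'
        exact ⟨_, Or.inr (.insertLeft β (by linarith)), _, h.insertLeft h0 h1 h2⟩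
    · -- a value which is taken once
      replace h2 : Φ (j + 2) = i + 2 := by omega
      have h' := h.reflect_inr h0 h1 h2
      have hdec : β.reflectVal A (Sum.inr i) (Sum.inr i) < β.val (Sum.inr i) := by
        rw [h'.apply_inr, h.apply_inr, h1, ElasticData.profile_succ,
          ElasticData.profile_succ] at hlt
        exact hlt
      by_cases hmark : β.lo ≤ i ∧ i ≤ β.hi
      swap
      · exact ⟨β.reflect A (Sum.inr i), Or.inr (.unmarked β _ hmark hdec), Φ, h'⟩
      rcases lt_or_eq_of_le hmark.1 with hlo | rfl
      · rcases lt_or_eq_of_le hmark.2 with hhi | rfl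
        · exact ⟨β.reflect A (Sum.inr i), Or.inr (.internal β i hlo hhi hdec), Φ, h'⟩
        · rw [Fin.lt_def] at hlo
          obtain ⟨k, hk⟩ : ∃ k : Fin (β.m + 1), (k : ℕ) + 1 = β.hi :=
            ⟨⟨β.hi - 1, by omega⟩, by simp; omega⟩
          have hklo : β.lo ≤ k := by rw [Fin.le_def]; omega
          rcases lt_or_ge (β.reflectVal A (Sum.inr β.hi) (Sum.inr β.hi)) (β.val (Sum.inr k))
            with hlt2 | hge
          · exact ⟨β.reflect A (Sum.inr β.hi), Or.inr (.rightKeep β k hk hklo hdec hlt2), Φ, h'⟩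
          · exact ⟨_, Or.inr (.rightDrop β k hk hklo hdec hge), Φ,
              h'.map.dropRight (by omega) h0 h2 hk, h'.inl, h'.profile⟩
      · rcases lt_or_eq_of_le hmark.2 with hhi | heq
        · rw [Fin.lt_def] at hhi
          obtain ⟨k, hk⟩ : ∃ k : Fin (β.m + 1), (β.lo : ℕ) + 1 = k :=
            ⟨⟨β.lo + 1, by omega⟩, rfl⟩
          have hkhi : k ≤ β.hi := by rw [Fin.le_def]; omega
          rcases lt_or_ge (β.reflectVal A (Sum.inr β.lo) (Sum.inr β.lo)) (β.val (Sum.inr k))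
            with hlt2 | hge
          · exact ⟨β.reflect A (Sum.inr β.lo), Or.inr (.leftKeep β k hk hkhi hdec hlt2), Φ, h'⟩
          · exact ⟨_, Or.inr (.leftDrop β k hk hkhi hdec hge), Φ,
              hk ▸ h'.map.dropLeft (by omega) h0 h2, h'.inl, h'.profile⟩
        -- The sole asterisked value is taken once, so `n = β.m`, which `hn` excludes.
        · have hmap := h.map
          rw [← heq] at hmap
          exact absurd (hmap.eq_of_lo_eq_hi (by omega) h0 h2) (hn heq)
  · replace h0 : Φ j = i + 1 := by omega
    rcases Nat.lt_or_ge (Φ (j + 2)) (i + 2) with h2 | h2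
    -- In the interior of a block the reflection fixes the function, so it cannot decrease.
    · replace h2 : Φ (j + 2) = i + 1 := by omega
      rw [h0, h1, h2] at hlt'
      linarith
    · -- the end of a block of length at least two
      replace h2 : Φ (j + 2) = i + 2 := by omega
      rcases Nat.lt_or_ge i β.hi with hi | hi
      · exact ⟨β, Or.inl rfl, _, h.shiftRight h0 h1 h2 (by omega) hi⟩
      · obtain rfl : i = β.hi := Fin.ext (by omega)
        rw [h0, h1, h2, ElasticData.profile_succ, ← rightSum_eq] at hlt'
        exact ⟨_, Or.inr (.insertRight β (by linarith)), _, h.insertRight h0 h1 h2⟩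

/-! ### Finiteness, acyclicity and admissibility of the graph -/

section Invariants

variable {A : Matrix V V ℤ}

theorem reflectVal_of_ne (β : StretchingNotation E) {v w : E.Vertex β.m} (h : w ≠ v) :
    β.reflectVal A v w = β.val w :=
  simpleReflection_of_ne _ h _

theorem reflectVal_le (β : StretchingNotation E) {v : E.Vertex β.m}
    (h : β.reflectVal A v v < β.val v) (w : E.Vertex β.m) : β.reflectVal A v w ≤ β.val w := by
  by_cases hw : w = v
  · subst hw
    exact h.le
  · exact (β.reflectVal_of_ne hw).le

theorem Operation.val_le {β γ : StretchingNotation E} (h : Operation A β γ) {B : ℤ}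
    (hB : ∀ v, β.val v ≤ B) : ∀ v, γ.val v ≤ B := by
  cases h with
  | unmarked v hv hdec => exact fun w => (β.reflectVal_le hdec w).trans (hB w)
  | internal i hlo hhi hdec => exact fun w => (β.reflectVal_le hdec w).trans (hB w)
  | leftKeep k hk hkhi hdec hlt => exact fun w => (β.reflectVal_le hdec w).trans (hB w)
  | leftDrop k hk hkhi hdec hlt => exact fun w => (β.reflectVal_le hdec w).trans (hB w)
  | rightKeep k hk hkhi hdec hlt => exact fun w => (β.reflectVal_le hdec w).trans (hB w)
  | rightDrop k hk hkhi hdec hlt => exact fun w => (β.reflectVal_le hdec w).trans (hB w)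
  | insertLeft hlt =>
    intro w
    rcases β.insertLeft_val_cases (β.leftSum A) w with h | ⟨u, h⟩ <;> rw [h]
    · exact hlt.le.trans (hB _)
    · exact hB _
  | insertRight hlt =>
    intro w
    rcases β.insertRight_val_cases (β.rightSum A) w with h | ⟨u, h⟩ <;> rw [h]
    · exact hlt.le.trans (hB _)
    · exact hB _

/-- Each insertion decreases the coefficient of an endpoint, and no operation increases it. -/
theorem Operation.endpoints_le {β γ : StretchingNotation E} (h : Operation A β γ) :
    (γ.m : ℤ) + γ.val (Sum.inr γ.lo) + γ.val (Sum.inr γ.hi) ≤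
      β.m + β.val (Sum.inr β.lo) + β.val (Sum.inr β.hi) := by
  cases h with
  | unmarked v hv hdec =>
    exact add_le_add (add_le_add le_rfl (β.reflectVal_le hdec _)) (β.reflectVal_le hdec _)
  | internal i hlo hhi hdec =>
    exact add_le_add (add_le_add le_rfl (β.reflectVal_le hdec _)) (β.reflectVal_le hdec _)
  | leftKeep k hk hkhi hdec hlt =>
    exact add_le_add (add_le_add le_rfl (β.reflectVal_le hdec _)) (β.reflectVal_le hdec _)
  | rightKeep k hk hkhi hdec hlt =>
    exact add_le_add (add_le_add le_rfl (β.reflectVal_le hdec _)) (β.reflectVal_le hdec _)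
  | leftDrop k hk hkhi hdec hge =>
    -- The new endpoint is the former neighbour; by `hge` its value is at most the reflected value,
    -- hence below that of the old endpoint.
    refine add_le_add (add_le_add le_rfl ?_) (β.reflectVal_le hdec _)
    exact (β.reflectVal_le hdec _).trans (hge.trans hdec.le)
  | rightDrop k hk hkhi hdec hge =>
    refine add_le_add (add_le_add le_rfl (β.reflectVal_le hdec _)) ?_
    exact (β.reflectVal_le hdec _).trans (hge.trans hdec.le)
  | insertLeft hlt =>
    rw [insertLeft_val_lo]
    have : (β.insertLeft (β.leftSum A)).val (Sum.inr (β.insertLeft (β.leftSum A)).hi) =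
      β.val (Sum.inr β.hi) := β.insertLeft_val_succ _ _ β.lo_le_hi
    rw [this]
    simp only [StretchingNotation.insertLeft]
    push_cast
    linarith
  | insertRight hlt =>
    rw [insertRight_val_hi]
    have : (β.insertRight (β.rightSum A)).val (Sum.inr (β.insertRight (β.rightSum A)).lo) =
      β.val (Sum.inr β.lo) := β.insertRight_val_castSucc _ _ β.lo_le_hi
    rw [this]
    simp only [StretchingNotation.insertRight]
    push_cast
    linarith

/-- Every operation either enlarges the path or decreases the sum of all coefficients. -/
theorem Operation.lt_or_sum_lt {β γ : StretchingNotation E} (h : Operation A β γ) :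
    β.m < γ.m ∨ β.m = γ.m ∧ ∑ v, γ.val v < ∑ v, β.val v := by
  have key : ∀ v, β.reflectVal A v v < β.val v → ∑ w, β.reflectVal A v w < ∑ w, β.val w :=
    fun v hv => Finset.sum_lt_sum (fun w _ => β.reflectVal_le hv w) ⟨v, Finset.mem_univ _, hv⟩
  cases h with
  | unmarked v hv hdec => exact Or.inr ⟨rfl, key _ hdec⟩
  | internal i hlo hhi hdec => exact Or.inr ⟨rfl, key _ hdec⟩
  | leftKeep k hk hkhi hdec hlt => exact Or.inr ⟨rfl, key _ hdec⟩
  | leftDrop k hk hkhi hdec hlt => exact Or.inr ⟨rfl, key _ hdec⟩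
  | rightKeep k hk hkhi hdec hlt => exact Or.inr ⟨rfl, key _ hdec⟩
  | rightDrop k hk hkhi hdec hlt => exact Or.inr ⟨rfl, key _ hdec⟩
  | insertLeft hlt => exact Or.inl (Nat.lt_succ_self _)
  | insertRight hlt => exact Or.inl (Nat.lt_succ_self _)

theorem not_transGen_arrow_self (β : StretchingNotation E) :
    ¬ Relation.TransGen (Arrow A) β β := by
  have key : ∀ γ, Relation.TransGen (Arrow A) β γ →
      β.m < γ.m ∨ β.m = γ.m ∧ ∑ v, γ.val v < ∑ v, β.val v := by
    intro γ h
    induction h with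
    | single h => exact h.1.lt_or_sum_lt
    | tail _ h ih =>
      rcases h.1.lt_or_sum_lt with h | h <;> rcases ih with ih | ih
      · left; omega
      · left; omega
      · left; omega
      · exact Or.inr ⟨ih.1.trans h.1, h.2.trans ih.2⟩
  intro h
  rcases key β h with h | h
  · exact lt_irrefl _ h
  · exact lt_irrefl _ h.2

/-- An internal reflection exchanges two nonzero differences. An endpoint keeps its asterisk only
when strictly below its neighbour, an inserted value is strictly below the old endpoint, and the
other operations create no new adjacent pair of asterisked values. -/
theorem Operation.admissible {β γ : StretchingNotation E} (h : Operation A β γ)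
    (hβ : β.Admissible) : γ.Admissible := by
  have hlh : (β.lo : ℕ) ≤ β.hi := β.lo_le_hi
  cases h with
  | unmarked v hv hdec =>
    intro (i : Fin (β.m + 1)) (j : Fin (β.m + 1)) (hi : β.lo ≤ i) (hj : j ≤ β.hi)
      (hij : (i : ℕ) + 1 = j)
    have hi' : (β.lo : ℕ) ≤ i := hi
    have hj' : (j : ℕ) ≤ β.hi := hj
    have h1 : Sum.inr i ≠ v := by
      rintro rfl
      exact hv ⟨hi, by rw [Fin.le_def]; omega⟩
    have h2 : Sum.inr j ≠ v := by
      rintro rfl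
      exact hv ⟨by rw [Fin.le_def]; omega, hj⟩
    change β.reflectVal A v (Sum.inr i) ≠ β.reflectVal A v (Sum.inr j)
    rw [reflectVal_of_ne _ h1, reflectVal_of_ne _ h2]
    exact hβ i j hi hj hij
  | internal k hlo hhi hdec =>
    intro (i : Fin (β.m + 1)) (j : Fin (β.m + 1)) (hi : β.lo ≤ i) (hj : j ≤ β.hi)
      (hij : (i : ℕ) + 1 = j)
    have hi' : (β.lo : ℕ) ≤ i := hi
    have hj' : (j : ℕ) ≤ β.hi := hj
    rw [Fin.lt_def] at hlo hhi
    change β.reflectVal A (Sum.inr k) (Sum.inr i) ≠ β.reflectVal A (Sum.inr k) (Sum.inr j)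
    have hself : β.reflectVal A (Sum.inr k) (Sum.inr k) =
        E.profile A β.val k + E.profile A β.val (k + 2) - E.profile A β.val (k + 1) :=
      ElasticData.simpleReflection_inr_self E A β.val k
    by_cases hik : i = k
    · subst hik
      have hne : j ≠ i := by rintro rfl; omega
      rw [reflectVal_of_ne _ (w := Sum.inr j) (by simpa using hne), hself, show (i : ℕ) + 2 = j + 1 by omega,
        ElasticData.profile_succ, ElasticData.profile_succ]
      have := hβ ⟨i - 1, by omega⟩ i (by rw [Fin.le_def]; simp only; omega)
        (by rw [Fin.le_def]; omega) (by simp only; omega)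
      rw [← ElasticData.profile_succ E A β.val, ← ElasticData.profile_succ E A β.val] at this
      simp only at this
      rw [show (i : ℕ) - 1 + 1 = i by omega, ElasticData.profile_succ] at this
      intro he
      apply this
      linarith
    · by_cases hjk : j = k
      · subst hjk
        rw [reflectVal_of_ne _ (by simpa using hik), hself, ← hij, ElasticData.profile_succ]
        have := hβ j ⟨j + 1, by omega⟩ (by rw [Fin.le_def]; omega)
          (by rw [Fin.le_def]; simp only; omega) rfl
        rw [← ElasticData.profile_succ E A β.val, ← ElasticData.profile_succ E A β.val] at this
        simp only at this
        rw [hij]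
        intro he
        apply this
        change _ = E.profile A β.val (j + 2)
        linarith
      · rw [reflectVal_of_ne _ (by simpa using hik), reflectVal_of_ne _ (by simpa using hjk)]
        exact hβ i j hi hj hij
  | leftKeep k hk hkhi hdec hlt =>
    intro (i : Fin (β.m + 1)) (j : Fin (β.m + 1)) (hi : β.lo ≤ i) (hj : j ≤ β.hi)
      (hij : (i : ℕ) + 1 = j)
    have hi' : (β.lo : ℕ) ≤ i := hi
    change β.reflectVal A (Sum.inr β.lo) (Sum.inr i) ≠ β.reflectVal A (Sum.inr β.lo) (Sum.inr j)
    have hne : j ≠ β.lo := by rintro rfl; omega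
    rw [reflectVal_of_ne _ (w := Sum.inr j) (by simpa using hne)]
    by_cases hil : i = β.lo
    · subst hil
      obtain rfl : j = k := Fin.ext (by omega)
      exact hlt.ne
    · rw [reflectVal_of_ne _ (by simpa using hil)]
      exact hβ i j hi hj hij
  | rightKeep k hk hklo hdec hlt =>
    intro (i : Fin (β.m + 1)) (j : Fin (β.m + 1)) (hi : β.lo ≤ i) (hj : j ≤ β.hi)
      (hij : (i : ℕ) + 1 = j)
    have hj' : (j : ℕ) ≤ β.hi := hj
    change β.reflectVal A (Sum.inr β.hi) (Sum.inr i) ≠ β.reflectVal A (Sum.inr β.hi) (Sum.inr j)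
    have hne : i ≠ β.hi := by rintro rfl; omega
    rw [reflectVal_of_ne _ (by simpa using hne)]
    by_cases hil : j = β.hi
    · subst hil
      obtain rfl : i = k := Fin.ext (by omega)
      exact hlt.ne'
    · rw [reflectVal_of_ne _ (by simpa using hil)]
      exact hβ i j hi hj hij
  | leftDrop k hk hkhi hdec hge =>
    intro (i : Fin (β.m + 1)) (j : Fin (β.m + 1)) (hi : k ≤ i) (hj : j ≤ β.hi)
      (hij : (i : ℕ) + 1 = j)
    have hi' : (k : ℕ) ≤ i := hi
    change β.reflectVal A (Sum.inr β.lo) (Sum.inr i) ≠ β.reflectVal A (Sum.inr β.lo) (Sum.inr j)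
    have h1 : i ≠ β.lo := by rintro rfl; omega
    have h2 : j ≠ β.lo := by rintro rfl; omega
    rw [reflectVal_of_ne _ (by simpa using h1), reflectVal_of_ne _ (by simpa using h2)]
    exact hβ i j (by rw [Fin.le_def]; omega) hj hij
  | rightDrop k hk hklo hdec hge =>
    intro (i : Fin (β.m + 1)) (j : Fin (β.m + 1)) (hi : β.lo ≤ i) (hj : j ≤ k)
      (hij : (i : ℕ) + 1 = j)
    have hj' : (j : ℕ) ≤ k := hj
    change β.reflectVal A (Sum.inr β.hi) (Sum.inr i) ≠ β.reflectVal A (Sum.inr β.hi) (Sum.inr j)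
    have h1 : i ≠ β.hi := by rintro rfl; omega
    have h2 : j ≠ β.hi := by rintro rfl; omega
    rw [reflectVal_of_ne _ (by simpa using h1), reflectVal_of_ne _ (by simpa using h2)]
    exact hβ i j hi (by rw [Fin.le_def]; omega) hij
  | insertLeft hlt =>
    intro (i : Fin (β.m + 1 + 1)) (j : Fin (β.m + 1 + 1)) (hi : β.lo.castSucc ≤ i)
      (hj : j ≤ β.hi.succ) (hij : (i : ℕ) + 1 = j) he
    rw [Fin.le_def] at hi hj
    simp only [Fin.val_castSucc, Fin.val_succ] at hi hj
    obtain ⟨j', rfl⟩ : ∃ j' : Fin (β.m + 1), j = j'.succ :=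
      ⟨⟨i, by omega⟩, Fin.ext (by simp; omega)⟩
    simp only [Fin.val_succ] at hij hj
    replace he := he.trans (β.insertLeft_val_succ _ j' (by rw [Fin.le_def]; omega))
    rcases hi.eq_or_lt with heq | hlt'
    · obtain rfl : i = β.lo.castSucc := Fin.ext heq.symm
      obtain rfl : j' = β.lo := Fin.ext (by simp at hij; omega)
      exact hlt.ne ((β.insertLeft_val_lo _).symm.trans he)
    · obtain ⟨i', rfl⟩ : ∃ i' : Fin (β.m + 1), i = i'.succ :=
        ⟨⟨i - 1, by omega⟩, Fin.ext (by simp; omega)⟩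
      simp only [Fin.val_succ] at hij hlt'
      exact hβ i' j' (by rw [Fin.le_def]; omega) (by rw [Fin.le_def]; omega) (by omega)
        ((β.insertLeft_val_succ _ i' (by rw [Fin.le_def]; omega)).symm.trans he)
  | insertRight hlt =>
    intro (i : Fin (β.m + 1 + 1)) (j : Fin (β.m + 1 + 1)) (hi : β.lo.castSucc ≤ i)
      (hj : j ≤ β.hi.succ) (hij : (i : ℕ) + 1 = j) he
    rw [Fin.le_def] at hi hj
    simp only [Fin.val_castSucc, Fin.val_succ] at hi hj
    obtain ⟨i', rfl⟩ : ∃ i' : Fin (β.m + 1), i = i'.castSucc :=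
      ⟨⟨i, by omega⟩, rfl⟩
    simp only [Fin.val_castSucc] at hij hi
    replace he := (β.insertRight_val_castSucc _ i' (by rw [Fin.le_def]; omega)).symm.trans he
    rcases hj.eq_or_lt with heq | hlt'
    · obtain rfl : j = β.hi.succ := Fin.ext heq
      obtain rfl : i' = β.hi := Fin.ext (by simp at hij; omega)
      exact hlt.ne' (he.trans (β.insertRight_val_hi _))
    · obtain ⟨j', rfl⟩ : ∃ j' : Fin (β.m + 1), j = j'.castSucc :=
        ⟨⟨j, by omega⟩, rfl⟩
      simp only [Fin.val_castSucc] at hij hlt'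
      exact hβ i' j' (by rw [Fin.le_def]; omega) (by rw [Fin.le_def]; omega) (by omega)
        (he.trans (β.insertRight_val_castSucc _ j' (by rw [Fin.le_def]; omega)))

theorem finite_setOf_bounded (K : ℕ) (B : ℤ) :
    {β : StretchingNotation E | β.m ≤ K ∧ ∀ v, 0 ≤ β.val v ∧ β.val v ≤ B}.Finite := by
  let build : ∀ m, ((E.Vertex m → ℤ) × {p : Fin (m + 1) × Fin (m + 1) // p.1 ≤ p.2}) →
      StretchingNotation E := fun m q => ⟨m, q.1, q.2.1.1, q.2.1.2, q.2.2⟩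
  refine ((Set.finite_Iic K).biUnion fun m _ =>
    ((Set.Finite.pi' (t := fun _ : E.Vertex m => Set.Icc (0 : ℤ) B)
      fun _ => Set.finite_Icc _ _).prod Set.finite_univ).image (build m)).subset ?_
  rintro ⟨m, val, lo, hi, hle⟩ ⟨h1, h2⟩
  simp only [Set.mem_iUnion]
  exact ⟨m, h1, (val, ⟨(lo, hi), hle⟩), ⟨h2, Set.mem_univ _⟩, rfl⟩

/-- By `endpoints_le` and nonnegativity of the endpoint values, `m` is at most twice `α E.x`, its
starting value being `0`. Coefficients never exceed the maximum of `α`, so finitely many notations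
remain. -/
theorem stableGraph_finite {α : V → ℤ} (hα : ∀ i, 0 ≤ α i) : (stableGraph E A α).Finite := by
  obtain ⟨B, hB⟩ : ∃ B, ∀ i, α i ≤ B := by
    obtain ⟨B, hB⟩ := (Set.finite_range α).bddAbove
    exact ⟨B, fun i => hB ⟨i, rfl⟩⟩
  refine (finite_setOf_bounded (2 * α E.x).toNat B).subset fun β hβ => ?_
  have key : (∀ v, 0 ≤ β.val v) ∧ (∀ v, β.val v ≤ B) ∧
      (β.m : ℤ) + β.val (Sum.inr β.lo) + β.val (Sum.inr β.hi) ≤ 2 * α E.x := by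
    induction hβ with
    | refl =>
      refine ⟨?_, ?_, ?_⟩
      · rintro (v | i)
        · exact hα _
        · exact hα _
      · rintro (v | i)
        · exact hB _
        · exact hB _
      · simp [star, ElasticData.stretch, two_mul]
    | tail _ h ih => exact ⟨h.2, h.1.val_le ih.2.1, h.1.endpoints_le.trans ih.2.2⟩
  have h1 := key.1 (Sum.inr β.lo)
  have h2 := key.1 (Sum.inr β.hi)
  exact ⟨by have := key.2.2; omega, fun v => ⟨key.1 v, key.2.1 v⟩⟩

theorem stableGraph_admissible {α : V → ℤ} {β : StretchingNotation E}
    (hβ : β ∈ stableGraph E A α) : β.Admissible := by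
  induction hβ with
  | refl =>
    intro i j _ _ hij
    have hi : (i : ℕ) < 0 + 1 := i.2
    have hj : (j : ℕ) < 0 + 1 := j.2
    omega
  | tail _ h ih => exact h.1.admissible ih

end Invariants

end StretchingNotation

/-! ### Stretches of roots are roots -/

namespace ElasticData

variable {V : Type*} [Fintype V] [DecidableEq V] {M : CoxeterMatrix V} (E : ElasticData M)

/-- The function which is `u` off the stretched path, `b` on the first `k` vertices of the path and
`c` on the others. -/
def twoStep {n : ℕ} (u : {v : V // v ≠ E.x} → ℤ) (b c : ℤ) (k : ℕ) : E.Vertex n → ℤ :=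
  Sum.elim u (fun i => if (i : ℕ) < k then b else c)

variable (A : Matrix V V ℤ) {n : ℕ} (u : {v : V // v ≠ E.x} → ℤ)

theorem profile_twoStep_of_le (b c : ℤ) {i k : ℕ} (hi : i ≤ k) (hk : k ≤ n + 1)
    (hb : b = E.leftWeight A u) : E.profile A (n := n) (E.twoStep u b c k) i = b := by
  rcases Nat.eq_zero_or_pos i with rfl | hi0
  · rw [profile_zero, hb]
    rfl
  · rw [profile, if_neg (by omega), dif_pos (by omega)]
    simp only [twoStep, Sum.elim_inr]
    rw [if_pos (by omega)]

theorem profile_twoStep_of_lt (b c : ℤ) {i k : ℕ} (hi : k < i) (hn : i ≤ n + 1) :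
    E.profile A (n := n) (E.twoStep u b c k) i = c := by
  rw [profile, if_neg (by omega), dif_pos (by omega)]
  simp only [twoStep, Sum.elim_inr]
  rw [if_neg (by omega)]

/-- When `b` is the left weight, the vertex after the last `b` has left profile neighbour `b` and
right neighbour `c`, so reflection carries `b` one vertex further. -/
theorem simpleReflection_twoStep (b c : ℤ) (hb : b = E.leftWeight A u) {k : ℕ} (hk : k < n) :
    simpleReflection (E.stCartan A n) (Sum.inr ⟨k, by omega⟩) (E.twoStep u b c k) =
      E.twoStep u b c (k + 1) := by
  funext v
  by_cases hv : v = Sum.inr ⟨k, by omega⟩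
  · subst hv
    rw [simpleReflection_inr_self, profile_twoStep_of_le E A u b c le_rfl (by omega) hb,
      profile_twoStep_of_lt E A u b c (by simp) (by simp; omega),
      profile_twoStep_of_lt E A u b c (by simp) (by simp; omega)]
    simp [twoStep]
  · rw [simpleReflection_of_ne _ hv]
    rcases v with v | i
    · rfl
    · have : (i : ℕ) ≠ k := fun h => hv (congrArg Sum.inr (Fin.ext h))
      simp only [twoStep, Sum.elim_inr]
      split_ifs <;> first | rfl | omega

theorem simpleReflection_twoStep_last (b c : ℤ) (hb : b = E.leftWeight A u) :
    simpleReflection (E.stCartan A n) (Sum.inr (Fin.last n)) (E.twoStep u b c n) =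
      E.twoStep u b (b + E.rightWeight A u - c) n := by
  funext v
  by_cases hv : v = Sum.inr (Fin.last n)
  · subst hv
    rw [simpleReflection_inr_self, profile_twoStep_of_le E A u b c (by simp) (by simp) hb,
      profile_of_le E A _ (by simp), profile_twoStep_of_lt E A u b c (by simp) (by simp)]
    simp [twoStep]
  · rw [simpleReflection_of_ne _ hv]
    rcases v with v | i
    · rfl
    · have : (i : ℕ) < n := Fin.val_lt_last fun h => hv (by rw [h])
      simp only [twoStep, Sum.elim_inr, if_pos this]

variable {A}

theorem isRoot_twoStep_iff (hA : ∀ i, A i i = 2) (b c : ℤ) (hb : b = E.leftWeight A u) {k : ℕ}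
    (hk : k ≤ n) : IsRoot (E.stCartan A n) (E.twoStep u b c k) ↔
      IsRoot (E.stCartan A n) (E.twoStep u b c 0) := by
  induction k with
  | zero => rfl
  | succ k ih =>
    rw [← ih (by omega), ← simpleReflection_twoStep E A u b c hb hk]
    refine ⟨fun h => ?_, fun h => isRoot_simpleReflection h _⟩
    have := isRoot_simpleReflection h (Sum.inr ⟨k, by omega⟩)
    rwa [simpleReflection_simpleReflection _ (E.stCartan_self A hA _)] at this

omit [Fintype V] in
theorem stretch_eq_twoStep (α : V → ℤ) (b : ℤ) :
    E.stretch n α = E.twoStep (fun v => α v) b (α E.x) 0 := by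
  funext v
  rcases v with v | i <;> simp [stretch, twoStep]

omit [Fintype V] in
theorem isCartanMatrix_eq_zero (hA : IsCartanMatrix M A) {z : V} (hz : z ≠ E.x)
    (hl : z ∉ E.left) (hr : z ∉ E.right) : A E.x z = 0 ∧ A z E.x = 0 := by
  have h1 : ¬ (coxeterDiagram M).Adj E.x z := by
    rw [← E.neighbors]
    simp [hl, hr]
  have h2 : M E.x z = 2 := by
    by_contra h
    exact h1 ⟨hz.symm, h⟩
  exact ⟨hA.two _ _ h2, hA.two _ _ ((M.symmetric _ _).trans h2)⟩

theorem leftWeight_add_rightWeight (hA : IsCartanMatrix M A) :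
    E.leftWeight A u + E.rightWeight A u = -∑ z : {v : V // v ≠ E.x}, A E.x z * u z := by
  rw [leftWeight, rightWeight, ← Finset.sum_add_distrib, ← Finset.sum_neg_distrib]
  refine Finset.sum_congr rfl fun z _ => ?_
  by_cases hl : z.1 ∈ E.left
  · have hr : z.1 ∉ E.right := Finset.disjoint_left.1 E.disjoint hl
    simp [hl, hr]
  · by_cases hr : z.1 ∈ E.right
    · simp [hl, hr]
    · simp [hl, hr, (E.isCartanMatrix_eq_zero hA z.2 hl hr).1]

/-- Off `x`, stretching commutes with the reflection. At `x`, reflecting at `x_0, …, x_{n-1}`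
spreads the left weight along the path, reflecting at `x_n` brings in the right weight and produces
the coefficient of `s_x(α)` there, and reflecting back through `x_{n-1}, …, x_0` spreads this
coefficient over the whole path. -/
theorem isRoot_stretch_simpleReflection (hA : IsCartanMatrix M A) {α : V → ℤ}
    (h : IsRoot (E.stCartan A n) (E.stretch n α)) (i : V) :
    IsRoot (E.stCartan A n) (E.stretch n (simpleReflection A i α)) := by
  have hsum : ∀ j, ∑ v, A j v * α v =
      A j E.x * α E.x + ∑ z : {v : V // v ≠ E.x}, A j z * α z := fun j =>
    Fintype.sum_eq_add_sum_subtype_ne (fun v => A j v * α v) E.x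
  by_cases hi : i = E.x
  · subst hi
    have hu : (fun v : {v : V // v ≠ E.x} => simpleReflection A E.x α v) =
        fun v : {v : V // v ≠ E.x} => α v :=
      funext fun v : {v : V // v ≠ E.x} => simpleReflection_of_ne A v.2 α
    have hx : simpleReflection A E.x α E.x = E.leftWeight A (fun v => α v) +
        E.rightWeight A (fun v => α v) - α E.x := by
      rw [leftWeight_add_rightWeight E _ hA, simpleReflection_self, hsum, hA.diag]
      ring
    rw [E.stretch_eq_twoStep _ (E.leftWeight A (fun v => α v))] at h ⊢
    rw [hu, hx, ← E.isRoot_twoStep_iff _ hA.diag _ _ rfl le_rfl,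
      ← simpleReflection_twoStep_last E A _ _ _ rfl]
    exact isRoot_simpleReflection ((E.isRoot_twoStep_iff _ hA.diag _ _ rfl le_rfl).2 h) _
  · have : E.stretch n (simpleReflection A i α) =
        simpleReflection (E.stCartan A n) (Sum.inl ⟨i, hi⟩) (E.stretch n α) := by
      funext v
      rcases v with v | j
      · by_cases hv : v = ⟨i, hi⟩
        · subst hv
          rw [simpleReflection_self, sum_stCartan_inl]
          simp only [stretch, Sum.elim_inl, Sum.elim_inr]
          rw [simpleReflection_self, hsum]
          have hw : (if i ∈ E.left then A i E.x else 0) * α E.x +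
              (if i ∈ E.right then A i E.x else 0) * α E.x = A i E.x * α E.x := by
            by_cases hl : i ∈ E.left
            · have hr : i ∉ E.right := Finset.disjoint_left.1 E.disjoint hl
              simp [hl, hr]
            · by_cases hr : i ∈ E.right
              · simp [hl, hr]
              · simp [hl, hr, (E.isCartanMatrix_eq_zero hA hi hl hr).2]
          rw [hw]
          ring
        · rw [simpleReflection_of_ne _ (by simpa using hv)]
          exact simpleReflection_of_ne _ (fun h => hv (Subtype.ext h)) _
      · rw [simpleReflection_of_ne _ (by simp)]
        exact simpleReflection_of_ne _ (fun h => hi h.symm) _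
    rw [this]
    exact isRoot_simpleReflection h _

theorem isRoot_stretch (hA : IsCartanMatrix M A) {α : V → ℤ} (h : IsRoot A α) :
    IsRoot (E.stCartan A n) (E.stretch n α) := by
  obtain ⟨w, i, rfl⟩ := h
  induction w with
  | cons j w ih => exact E.isRoot_stretch_simpleReflection hA ih j
  | nil =>
    simp only [List.foldr_nil]
    by_cases hi : i = E.x
    · subst hi
      -- The stretch of `α_x` is the sum of the simple roots along the path. Its left weight is `0`,
      -- so reflections carry it to the simple root of `x_n`.
      rw [E.stretch_eq_twoStep _ 0, ← E.isRoot_twoStep_iff _ hA.diag _ _ ?_ le_rfl]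
      · refine ⟨[], Sum.inr (Fin.last n), ?_⟩
        funext v
        rcases v with v | j
        · simp [twoStep, simpleRoot, v.2]
        · simp only [twoStep, simpleRoot, Sum.elim_inr, List.foldr_nil, Pi.single_apply,
            Sum.inr.injEq, if_true, Fin.ext_iff, Fin.val_last]
          have := j.is_le
          split_ifs <;> first | rfl | omega
      · rw [leftWeight]
        refine (Finset.sum_eq_zero fun z _ => ?_).symm
        simp [simpleRoot, z.2]
    · refine ⟨[], Sum.inl ⟨i, hi⟩, ?_⟩
      funext v
      rcases v with v | j
      · simp [stretch, simpleRoot, Pi.single_apply, Subtype.ext_iff]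
      · simp [stretch, simpleRoot, Ne.symm hi]

theorem isPositiveRoot_stretch (hA : IsCartanMatrix M A) {α : V → ℤ} (h : IsPositiveRoot A α) :
    IsPositiveRoot (E.stCartan A n) (E.stretch n α) := by
  refine ⟨E.isRoot_stretch hA h.1, ?_⟩
  rintro (v | i) <;> exact h.2 _

end ElasticData

/-! ### The two inclusions and the theorem -/

namespace StretchingNotation

variable {V : Type*} [Fintype V] [DecidableEq V] {M : CoxeterMatrix V} {E : ElasticData M}
  {A : Matrix V V ℤ} {α : V → ℤ}

theorem iUnion_slice_subset_downset (hA : IsCartanMatrix M A) (hα : IsPositiveRoot A α) (n : ℕ) :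
    (⋃ β ∈ stableGraph E A α, β.slice n) ⊆ downset (E.stCartan A n) (E.stretch n α) := by
  refine Set.iUnion₂_subset fun β hβ => ?_
  induction hβ with
  | refl =>
    intro g hg
    rw [mem_slice_star] at hg
    subst hg
    exact ⟨E.isPositiveRoot_stretch hA hα, E.isPositiveRoot_stretch hA hα, .refl⟩
  | tail _ h ih =>
    exact slice_subset_of_arrow hA.diag (fun g v hg hnn hlt =>
      mem_downset_of_simpleReflection (E.stCartan_self A hA.diag v) hg hnn hlt) ih h

theorem downset_subset_iUnion_slice (hA : ∀ i, A i i = 2) {n : ℕ}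
    (hn : ∀ β ∈ stableGraph E A α, β.SingleAsterisk → β.m < n) :
    downset (E.stCartan A n) (E.stretch n α) ⊆ ⋃ β ∈ stableGraph E A α, β.slice n := by
  refine downset_subset (E.stCartan_self A hA)
    (Set.mem_iUnion₂.2 ⟨_, .refl, mem_slice_star.2 rfl⟩) fun g hg v hlt hnn => ?_
  obtain ⟨β, hβ, hg⟩ := Set.mem_iUnion₂.1 hg
  obtain ⟨γ, hγ, hg'⟩ := exists_operation (fun h => (hn β hβ h).ne') hg v hlt
  refine Set.mem_iUnion₂.2 ⟨γ, ?_, hg'⟩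
  rcases hγ with rfl | hγ
  · exact hβ
  · obtain ⟨Φ, h⟩ := (mem_slice_iff A γ _).1 hg'
    exact Relation.ReflTransGen.tail hβ ⟨hγ, h.nonneg_val hnn⟩

end StretchingNotation

theorem theorem3p3 {V : Type*} [Fintype V] [DecidableEq V] (M : CoxeterMatrix V)
    (A : Matrix V V ℤ) (hA : IsCartanMatrix M A) (E : ElasticData M)
    (α : V → ℤ) (hα : IsPositiveRoot A α) :
    (StretchingNotation.stableGraph E A α).Finite ∧
    (∀ β ∈ StretchingNotation.stableGraph E A α, β.Admissible) ∧
    (∀ β ∈ StretchingNotation.stableGraph E A α,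
      ¬ Relation.TransGen (StretchingNotation.Arrow A) β β) ∧
    (∃ n₀ : ℕ,
      IsLeast {k : ℕ | ∀ β ∈ StretchingNotation.stableGraph E A α,
        β.SingleAsterisk → (β.slice k).Nonempty} n₀ ∧
      ∀ n : ℕ, n₀ + 1 ≤ n →
        downset (E.stCartan A n) (E.stretch n α) =
          ⋃ β ∈ StretchingNotation.stableGraph E A α, β.slice n) ∧
    (∀ n : ℕ,
      (⋃ β ∈ StretchingNotation.stableGraph E A α, β.slice n) ⊆
        downset (E.stCartan A n) (E.stretch n α)) := by
  have hfin := StretchingNotation.stableGraph_finite (E := E) (A := A) hα.2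
  have hsub := StretchingNotation.iUnion_slice_subset_downset (E := E) hA hα
  refine ⟨hfin, fun β hβ => StretchingNotation.stableGraph_admissible hβ,
    fun β _ => β.not_transGen_arrow_self, ?_, hsub⟩
  -- As the graph is finite, any upper bound for the indices `m` of its notations belongs to this
  -- set.
  have hne : {k : ℕ | ∀ β ∈ StretchingNotation.stableGraph E A α,
      β.SingleAsterisk → (β.slice k).Nonempty}.Nonempty := by
    obtain ⟨K, hK⟩ := (hfin.image fun β => β.m).bddAbove
    exact ⟨K, fun β hβ _ => β.slice_nonempty (hK ⟨β, hβ, rfl⟩)⟩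
  refine ⟨_, ⟨Nat.sInf_mem hne, fun _ h => Nat.sInf_le h⟩, fun n hn => ?_⟩
  refine (StretchingNotation.downset_subset_iUnion_slice hA.diag fun β hβ h => ?_).antisymm (hsub n)
  -- A slice that is nonempty at `n₀` forces `β.m ≤ n₀ < n`, which rules out the exceptional case.
  exact Nat.lt_of_le_of_lt (StretchingNotation.le_of_slice_nonempty (Nat.sInf_mem hne β hβ h)) hn
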